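/- Assume Jensen's $\Diamond$-principle: there are sets $D_\alpha\subseteq\alpha$, for $\alpha<\omega_1$ limit, such that for every $S\subseteq\omega_1$ the set $\{\alpha<\omega_1 \text{ limit} : S\cap\alpha=D_\alpha\}$ is stationary in $\omega_1$. Then $\mathrm{FCA}(part)$ holds: for every good type $\tau=\langle m_k,n_{k+1},r_{k+1}\rangle_{k\in\omega}$ and every partition $\mathcal P$ of $\omega$ compatible with $\tau$, there is a $\mathcal P$-fully capturing construction scheme over $\omega_1$ of type $\tau$. The notions are as follows; $\mathrm{FIN}(X)$ is the set of nonempty finite subsets of $X$, $A\sqsubseteq B$ means that $A$ is an initial segment of $B$, and $A<B$ means that $B\neq\emptyset$ and $a<b$ for all $a\in A$, $b\in B$. A type is a sequence of triples of natural numbers such that $m_0=1$ and, for all $k\in\omega$, $n_{k+1}\ge 2$, $m_k>r_{k+1}$ and $m_{k+1}=r_{k+1}+(m_k-r_{k+1})n_{k+1}$. It is good if for each $r\in\omega$ there are infinitely many $k$ with $r_k=r$; a partition $\mathcal P$ of $\omega$ is compatible with it if for each $P\in\mathcal P$ and $r\in\omega$ there are infinitely many $k\in P$ with $r_k=r$.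 A construction scheme over a set of ordinals $X$ of type $\tau$ is a family $\mathcal F\subseteq \mathrm{FIN}(X)$ which, with $\mathcal F_k$ denoting the set of elements of rank $k$ of the well-founded order $(\mathcal F,\subseteq)$, satisfies: (a) every $A\in\mathrm{FIN}(X)$ is contained in some $F\in\mathcal F$; (b) $|F|=m_k$ for all $F\in\mathcal F_k$; (c) $E\cap F\sqsubseteq E$ and $E\cap F\sqsubseteq F$ for all $E,F\in\mathcal F_k$; (d) each $F\in\mathcal F_{k+1}$ is the union of some $F_0,\dots,F_{n_{k+1}-1}\in\mathcal F_k$ which form a $\Delta$-system with a root $R(F)$ such that $|R(F)|=r_{k+1}$ and $R(F)<F_0\setminus R(F)<\dots<F_{n_{k+1}-1}\setminus R(F)$ (these are uniquely determined by $F$). For such $\mathcal F$ let $\rho(\alpha,\beta)=\min\{k:\exists F\in\mathcal F_k\ \{\alpha,\beta\}\subseteq F\}$ and, for $A\in \mathrm{FIN}(X)$, $\rho^A=\max\{\rho(\alpha,\beta):\alpha,\beta\in A\}$ and $(A)_k=\{\alpha\in X:\exists\beta\in A\ (\alpha\le\beta,\ \rho(\alpha,\beta)\le k)\}$. For $l>\rho^A$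 and any $F\in\mathcal F_l$ with $A\subseteq F$, let $\Xi_A(l)=-1$ if $A\subseteq R(F)$, and $\Xi_A(l)=i$ if $A\not\subseteq R(F)$ and $A\subseteq F_i$ (this does not depend on $F$). Sets $A,B\in\mathrm{FIN}(X)$ with $\rho^A,\rho^B<l:=\rho^{A\cup B}$ are strongly $\rho$-isomorphic if $|(A)_{l-1}|=|(B)_{l-1}|$ and the increasing bijection $h:(A)_{l-1}\to(B)_{l-1}$ satisfies $h[A]=B$. A finite $\mathcal D\subseteq\mathrm{FIN}(X)$ is captured at level $l$ if $2\le|\mathcal D|\le n_l$; $l=\rho^{\bigcup\mathcal D}>\rho^D$ for each $D\in\mathcal D$; $\{\Xi_D(l):D\in\mathcal D\}=\{0,\dots,|\mathcal D|-1\}$; and any two distinct members of $\mathcal D$ are strongly $\rho$-isomorphic. It is fully captured at level $l$ if moreover $|\mathcal D|=n_l$. Finally, $\mathcal F$ is $\mathcal P$-fully capturing if for each uncountable $\mathcal S\subseteq\mathrm{FIN}(X)$ and each $P\in\mathcal P$ there are infinitely many $l\in P$ for which some finite $\mathcal D\subseteq\mathcal S$ is fully captured at level $l$. -/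

import Mathlib

open Ordinal

namespace ConstructionScheme

/-- A type `⟨m_k, n_{k+1}, r_{k+1}⟩`. The values `n 0` and `r 0` carry no meaning and
play no role anywhere. -/
structure SchemeType where
  m : ℕ → ℕ
  n : ℕ → ℕ
  r : ℕ → ℕ
  m_zero : m 0 = 1
  two_le_n : ∀ k, 2 ≤ n (k + 1)
  r_lt_m : ∀ k, r (k + 1) < m k
  m_succ : ∀ k, m (k + 1) = r (k + 1) + (m k - r (k + 1)) * n (k + 1)

/-- A type is good if every natural number occurs infinitely often among the `r_k`. -/
def SchemeType.IsGood (τ : SchemeType) : Prop :=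
  ∀ c : ℕ, {k | τ.r k = c}.Infinite

/-- A family `𝒬` of sets of natural numbers is compatible with `τ` if every natural number
occurs infinitely often among the `r_k` with `k ∈ P`, for each `P ∈ 𝒬`. -/
def SchemeType.Compatible (τ : SchemeType) (𝒬 : Set (Set ℕ)) : Prop :=
  ∀ P ∈ 𝒬, ∀ c : ℕ, {k | k ∈ P ∧ τ.r k = c}.Infinite

/-- The set `FIN(X)` of nonempty finite subsets of `X`. -/
def FIN (X : Set Ordinal.{0}) : Set (Finset Ordinal.{0}) :=
  {A | A.Nonempty ∧ (A : Set Ordinal.{0}) ⊆ X}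

/-- `A ⊑ B`: `A` is an initial segment of `B`. -/
def InitSeg (A B : Finset Ordinal.{0}) : Prop :=
  A ⊆ B ∧ ∀ x ∈ A, ∀ y ∈ B, y < x → y ∈ A

/-- `A < B`: `B` is nonempty and every element of `A` is below every element of `B`. -/
def Below (A B : Finset Ordinal.{0}) : Prop :=
  B.Nonempty ∧ ∀ a ∈ A, ∀ b ∈ B, a < b

/-- `ℱ_k`: the members of `ℱ` of rank `k` in the well-founded order `(ℱ, ⊂)`. -/
def level (ℱ : Set (Finset Ordinal.{0})) (k : ℕ) : Set (Finset Ordinal.{0}) :=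
  {F | ∃ h : F ∈ ℱ, IsWellFounded.rank (α := ℱ) (· < ·) ⟨F, h⟩ = (k : Ordinal)}

/-- `F` is the union of `P 0, …, P (n_{k+1} - 1) ∈ ℱ_k`, which form a `Δ`-system with root `R`
of size `r_{k+1}` and `R < P 0 \ R < ⋯ < P (n_{k+1} - 1) \ R`.
(The values `P i` for `i ≥ n_{k+1}` are irrelevant.) -/
structure IsDecomposition (τ : SchemeType) (ℱ : Set (Finset Ordinal.{0})) (k : ℕ)
    (F : Finset Ordinal.{0}) (P : ℕ → Finset Ordinal.{0}) (R : Finset Ordinal.{0}) : Prop where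
  mem_level : ∀ i < τ.n (k + 1), P i ∈ level ℱ k
  union_eq : F = (Finset.range (τ.n (k + 1))).biUnion P
  inter_eq : ∀ i < τ.n (k + 1), ∀ j < τ.n (k + 1), i ≠ j → P i ∩ P j = R
  card_root : R.card = τ.r (k + 1)
  root_below : ∀ i < τ.n (k + 1), Below R (P i \ R)
  tails_below : ∀ i j, i < j → j < τ.n (k + 1) → Below (P i \ R) (P j \ R)

/-- `ℱ` is a construction scheme over the set of ordinals `X` of type `τ`. -/
structure IsConstructionScheme (τ : SchemeType) (X : Set Ordinal.{0})
    (ℱ : Set (Finset Ordinal.{0})) : Prop where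
  subset_FIN : ℱ ⊆ FIN X
  cofinal : ∀ A ∈ FIN X, ∃ F ∈ ℱ, A ⊆ F
  card_eq : ∀ k, ∀ F ∈ level ℱ k, F.card = τ.m k
  initSeg : ∀ k, ∀ E ∈ level ℱ k, ∀ F ∈ level ℱ k, InitSeg (E ∩ F) E ∧ InitSeg (E ∩ F) F
  decomposition : ∀ k, ∀ F ∈ level ℱ (k + 1), ∃ P R, IsDecomposition τ ℱ k F P R

/-- The ordinal metric `ρ_ℱ`: the least `k` such that some member of `ℱ_k` contains
`α` and `β`. -/
noncomputable def rho (ℱ : Set (Finset Ordinal.{0})) (α β : Ordinal.{0}) : ℕ :=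
  sInf {k | ∃ F ∈ level ℱ k, α ∈ F ∧ β ∈ F}

/-- The diameter `ρ^A = max {ρ(α, β) : α, β ∈ A}`. -/
noncomputable def diam (ℱ : Set (Finset Ordinal.{0})) (A : Finset Ordinal.{0}) : ℕ :=
  (A ×ˢ A).sup fun p => rho ℱ p.1 p.2

/-- The `k`-closure `(A)_k = {α ∈ X : ∃ β ∈ A, α ≤ β and ρ(α, β) ≤ k}`. -/
def closure (X : Set Ordinal.{0}) (ℱ : Set (Finset Ordinal.{0})) (A : Finset Ordinal.{0})
    (k : ℕ) : Set Ordinal.{0} :=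
  {α | α ∈ X ∧ ∃ β ∈ A, α ≤ β ∧ rho ℱ α β ≤ k}

/-- `Ξ_A(l) = i`, for `l > ρ^A`: for a set `F ∈ ℱ_l` with `A ⊆ F`, either `A` is contained in the
root of `F` and `i = -1`, or `A` is not contained in the root and `A` is contained in the
`i`-th piece of `F`. -/
def XiEq (τ : SchemeType) (ℱ : Set (Finset Ordinal.{0})) (A : Finset Ordinal.{0}) (l : ℕ)
    (i : ℤ) : Prop :=
  ∃ k, l = k + 1 ∧ ∃ F ∈ level ℱ l, A ⊆ F ∧ ∃ P R, IsDecomposition τ ℱ k F P R ∧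
    ((A ⊆ R ∧ i = -1) ∨ (¬ A ⊆ R ∧ ∃ j < τ.n l, A ⊆ P j ∧ i = (j : ℤ)))

/-- `A` and `B` are strongly `ρ`-isomorphic: with `l = ρ^{A ∪ B} > ρ^A, ρ^B`, there is an
increasing bijection `h` from `(A)_{l-1}` onto `(B)_{l-1}` (necessarily unique), and `h[A] = B`. -/
def StronglyIsomorphic (X : Set Ordinal.{0}) (ℱ : Set (Finset Ordinal.{0}))
    (A B : Finset Ordinal.{0}) : Prop :=
  diam ℱ A < diam ℱ (A ∪ B) ∧ diam ℱ B < diam ℱ (A ∪ B) ∧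
    ∃ h : closure X ℱ A (diam ℱ (A ∪ B) - 1) ≃o closure X ℱ B (diam ℱ (A ∪ B) - 1),
      (fun x => (h x : Ordinal.{0})) '' {x | (x : Ordinal.{0}) ∈ A} = (B : Set Ordinal.{0})

/-- The finite family `𝒟` (of members of `FIN X`) is captured at level `l`. -/
structure IsCaptured (τ : SchemeType) (X : Set Ordinal.{0}) (ℱ : Set (Finset Ordinal.{0}))
    (𝒟 : Finset (Finset Ordinal.{0})) (l : ℕ) : Prop where
  two_le_card : 2 ≤ 𝒟.card
  card_le : 𝒟.card ≤ τ.n l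
  diam_union : diam ℱ (𝒟.biUnion id) = l
  diam_lt : ∀ D ∈ 𝒟, diam ℱ D < l
  xi_eq : {i : ℤ | ∃ D ∈ 𝒟, XiEq τ ℱ D l i} = {i : ℤ | 0 ≤ i ∧ i < 𝒟.card}
  stronglyIsomorphic : ∀ D ∈ 𝒟, ∀ E ∈ 𝒟, D ≠ E → StronglyIsomorphic X ℱ D E

/-- The finite family `𝒟` is fully captured at level `l`. -/
def IsFullyCaptured (τ : SchemeType) (X : Set Ordinal.{0}) (ℱ : Set (Finset Ordinal.{0}))
    (𝒟 : Finset (Finset Ordinal.{0})) (l : ℕ) : Prop :=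
  IsCaptured τ X ℱ 𝒟 l ∧ 𝒟.card = τ.n l

/-- `ℱ` is `𝒬`-fully capturing. -/
def IsFullyCapturing (τ : SchemeType) (X : Set Ordinal.{0}) (ℱ : Set (Finset Ordinal.{0}))
    (𝒬 : Set (Set ℕ)) : Prop :=
  ∀ 𝒮 : Set (Finset Ordinal.{0}), 𝒮 ⊆ FIN X → ¬ 𝒮.Countable → ∀ P ∈ 𝒬,
    {l | l ∈ P ∧ ∃ 𝒟 : Finset (Finset Ordinal.{0}),
      (𝒟 : Set (Finset Ordinal.{0})) ⊆ 𝒮 ∧ IsFullyCaptured τ X ℱ 𝒟 l}.Infinite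

/-- `D` is a `◇`-sequence over `ω₁`, indexed by the countable limit ordinals (other values of
`D` are irrelevant): `D α ⊆ α`, and for each `S ⊆ ω₁` the set of limit `α < ω₁` with
`S ∩ α = D α` is stationary in `ω₁`. -/
def IsDiamondSequence (D : Ordinal.{0} → Set Ordinal.{0}) : Prop :=
  (∀ α < ω₁, Order.IsSuccLimit α → D α ⊆ Set.Iio α) ∧
  ∀ S : Set Ordinal.{0}, S ⊆ Set.Iio ω₁ →
    IsStationary {α : Set.Iio (ω₁ : Ordinal.{0}) |
      Order.IsSuccLimit (α : Ordinal.{0}) ∧ S ∩ Set.Iio (α : Ordinal.{0}) = D α}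

/-- Jensen's `◇`-principle. -/
def DiamondPrinciple : Prop :=
  ∃ D : Ordinal.{0} → Set Ordinal.{0}, IsDiamondSequence D

end ConstructionScheme

/-!
Each limit block `[ω * ξ, ω * ξ + ω)` is put on top of the scheme already built below `ω * ξ` by
choosing an increasing sequence `E ξ` of finite sets, of levels `0, 1, 2, …`, which covers the
block. Only countably many requirements are met by `E ξ`, so it can be taken generic: for every
finite set `A` below `ω * ξ + ω`, for every `η ≤ ξ` and at infinitely many levels `k + 1`, the
set `A` becomes the next copy, after `j` disjoint-tailed copies lying in the guess `S η`, at the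
moment when the set of level `k` first meets the block of `η`. Here `j` is chosen as large as any
set of level `k + 1` below `ω * η` with the same root allows.

Given an uncountable `𝒮`, the principle `◇` provides `ξ` with `S ξ = 𝒮` below `ω * ξ` such that
`ω * ξ` reflects what happens above it. A member of `𝒮` reaching beyond `ω * ξ` completes `j + 1`
copies in `𝒮`; by reflection `j + 1` such copies exist below `ω * ξ`, which contradicts the
maximality of `j` unless all `n_{k+1}` copies have been used, that is, unless the copies are fully
captured.
-/

namespace ConstructionScheme

/-! ### Positions of pieces -/

namespace SchemeType

variable (τ : SchemeType)

/-- The position, in a set of level `k + 1`, of the `s`-th element of its `i`-th piece. -/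
def shift (k i s : ℕ) : ℕ :=
  if s < τ.r (k + 1) then s else s + i * (τ.m k - τ.r (k + 1))

variable {τ} {k i i' j s s' : ℕ}

theorem shift_of_lt (h : s < τ.r (k + 1)) : τ.shift k i s = s := by simp [shift, h]

theorem shift_of_le (h : τ.r (k + 1) ≤ s) :
    τ.shift k i s = s + i * (τ.m k - τ.r (k + 1)) := by simp [shift, h.not_gt]

@[simp]
theorem shift_zero : τ.shift k 0 s = s := by simp [shift]

theorem shift_strictMono (k i : ℕ) : StrictMono (τ.shift k i) := by
  intro a b hab
  unfold shift
  split_ifs <;> omega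

theorem le_shift : s ≤ τ.shift k i s := (shift_strictMono k i).le_apply

theorem shift_lt_of_lt (hs : s < τ.m k) (hij : i < j) :
    τ.shift k i s < τ.r (k + 1) + j * (τ.m k - τ.r (k + 1)) := by
  have hr := τ.r_lt_m k
  have : (i + 1) * (τ.m k - τ.r (k + 1)) ≤ j * (τ.m k - τ.r (k + 1)) :=
    Nat.mul_le_mul_right _ hij
  rw [add_mul] at this
  unfold shift
  split_ifs <;> omega

theorem shift_lt (hs : s < τ.m k) (hi : i < τ.n (k + 1)) : τ.shift k i s < τ.m (k + 1) := by
  rw [τ.m_succ, mul_comm]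
  exact shift_lt_of_lt hs hi

theorem shift_lt_shift (hs : s < τ.m k) (hs' : τ.r (k + 1) ≤ s') (hij : i < j) :
    τ.shift k i s < τ.shift k j s' := by
  have := shift_lt_of_lt hs hij
  rw [shift_of_le hs']
  omega

theorem shift_eq_shift (hs : s < τ.m k) (hs' : s' < τ.m k) (h : τ.shift k i s = τ.shift k i' s') :
    s = s' ∧ (i = i' ∨ s < τ.r (k + 1)) := by
  rcases lt_or_ge s (τ.r (k + 1)) with h₁ | h₁ <;> rcases lt_or_ge s' (τ.r (k + 1)) with h₂ | h₂
  · exact ⟨by rwa [shift_of_lt h₁, shift_of_lt h₂] at h, .inr h₁⟩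
  · rw [shift_of_lt h₁, shift_of_le h₂] at h
    omega
  · rw [shift_of_le h₁, shift_of_lt h₂] at h
    omega
  · rcases lt_trichotomy i i' with hi | rfl | hi
    · exact absurd h (shift_lt_shift hs h₂ hi).ne
    · exact ⟨(shift_strictMono k i).injective h, .inl rfl⟩
    · exact absurd h (shift_lt_shift hs' h₁ hi).ne'

theorem exists_shift_eq (hs : s < τ.m (k + 1)) :
    ∃ i < τ.n (k + 1), ∃ q < τ.m k, τ.shift k i q = s := by
  have hr := τ.r_lt_m k
  rcases lt_or_ge s (τ.r (k + 1)) with h | h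
  · exact ⟨0, by linarith [τ.two_le_n k], s, h.trans hr, shift_zero⟩
  · set d := τ.m k - τ.r (k + 1) with hd
    have hd₀ : 0 < d := by omega
    have hdiv := Nat.div_add_mod (s - τ.r (k + 1)) d
    have hmod := Nat.mod_lt (s - τ.r (k + 1)) hd₀
    rw [τ.m_succ, ← hd] at hs
    refine ⟨(s - τ.r (k + 1)) / d, ?_, τ.r (k + 1) + (s - τ.r (k + 1)) % d, by omega, ?_⟩
    · rw [Nat.div_lt_iff_lt_mul hd₀, mul_comm]
      omega
    · rw [shift_of_le (by omega), ← hd, mul_comm]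
      omega

theorem m_pos (k : ℕ) : 0 < τ.m k := (Nat.zero_le _).trans_lt (τ.r_lt_m k)

theorem n_pos (k : ℕ) : 0 < τ.n (k + 1) := zero_lt_two.trans_le (τ.two_le_n k)

theorem m_strictMono : StrictMono τ.m := by
  refine strictMono_nat_of_lt_succ fun k => ?_
  have hr := τ.r_lt_m k
  have : (τ.m k - τ.r (k + 1)) * 2 ≤ (τ.m k - τ.r (k + 1)) * τ.n (k + 1) :=
    Nat.mul_le_mul_left _ (τ.two_le_n k)
  rw [τ.m_succ]
  omega

end SchemeType

open SchemeType

/-- `IsPositionMap τ k j σ`: the map `σ` sends `s` to the position, in a set of level `j`, of the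
`s`-th element of one of its subsets of level `k`. -/
inductive IsPositionMap (τ : SchemeType) (k : ℕ) : ℕ → (ℕ → ℕ) → Prop
  | refl : IsPositionMap τ k k id
  | step {j i : ℕ} {σ : ℕ → ℕ} : IsPositionMap τ k j σ → i < τ.n (j + 1) →
      IsPositionMap τ k (j + 1) (τ.shift j i ∘ σ)

namespace IsPositionMap

variable {τ : SchemeType} {k j l : ℕ} {σ σ' : ℕ → ℕ}

theorem le (h : IsPositionMap τ k j σ) : k ≤ j := by
  induction h with
  | refl => rfl
  | step _ _ ih => omega

theorem strictMono (h : IsPositionMap τ k j σ) : StrictMono σ := by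
  induction h with
  | refl => exact strictMono_id
  | step _ _ ih => exact (shift_strictMono _ _).comp ih

theorem mapsTo (h : IsPositionMap τ k j σ) : Set.MapsTo σ (Set.Iio (τ.m k)) (Set.Iio (τ.m j)) := by
  induction h with
  | refl => exact Set.mapsTo_id _
  | step _ hi ih => exact fun s hs => shift_lt (ih hs) hi

theorem comp (h : IsPositionMap τ k j σ) (h' : IsPositionMap τ j l σ') :
    IsPositionMap τ k l (σ' ∘ σ) := by
  induction h' with
  | refl => exact h
  | step _ hi ih => exact ih.step hi

theorem eq_id (h : IsPositionMap τ k k σ) : σ = id := by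
  cases h with
  | refl => rfl
  | step h _ => exact absurd h.le (by omega)

theorem coherent (h : IsPositionMap τ k j σ) (h' : IsPositionMap τ k j σ') {a b : ℕ}
    (ha : a < τ.m k) (hb : b < τ.m k) (hab : σ a = σ' b) :
    a = b ∧ Set.EqOn σ σ' (Set.Iic a) := by
  induction h generalizing σ' with
  | refl =>
    obtain rfl := h'.eq_id
    exact ⟨hab, fun _ _ => rfl⟩
  | @step j i σ₁ h₁ _ ih =>
    cases h' with
    | refl => exact absurd h₁.le (by omega)
    | @step _ i' σ₂ h₂ hi' =>
      obtain ⟨e, hc⟩ := shift_eq_shift (h₁.mapsTo ha) (h₂.mapsTo hb) hab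
      obtain ⟨rfl, hs⟩ := ih h₂ e
      refine ⟨rfl, fun c hca => ?_⟩
      rcases hc with rfl | hc
      · simp [hs hca]
      · have hlt : σ₁ c < τ.r (j + 1) := (h₁.strictMono.monotone hca).trans_lt hc
        rw [Function.comp, Function.comp, ← hs hca, shift_of_lt hlt, shift_of_lt hlt]

theorem exists_apply_eq (hkj : k ≤ j) {p : ℕ} (hp : p < τ.m j) :
    ∃ σ, IsPositionMap τ k j σ ∧ ∃ q < τ.m k, σ q = p := by
  induction j, hkj using Nat.le_induction generalizing p with
  | base => exact ⟨id, refl, p, hp, rfl⟩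
  | succ j _ ih =>
    obtain ⟨i, hi, q, hq, rfl⟩ := exists_shift_eq hp
    obtain ⟨σ, hσ, q', hq', rfl⟩ := ih hq
    exact ⟨_, hσ.step hi, q', hq', rfl⟩

end IsPositionMap

/-! ### Enumerated schemes -/

/-- An enumeration of a finite set of ordinals in increasing order. Only the first `m` values
matter, where `m` is the size of the set. -/
abbrev Enumeration := ℕ → Ordinal.{0}

/-- The set enumerated by the first `m` values of `f`. -/
noncomputable def enumSet (m : ℕ) (f : Enumeration) : Finset Ordinal.{0} :=
  (Finset.range m).image f

/-- Two sets of the same size `m` meet in a common initial segment. -/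
def Coherent (m : ℕ) (f g : Enumeration) : Prop :=
  ∀ a < m, ∀ b < m, f a = g b → a = b ∧ Set.EqOn f g (Set.Iic a)

/-- `f` enumerates the `i`-th piece of the set of level `k + 1` enumerated by `g`. -/
def IsPiece (τ : SchemeType) (k i : ℕ) (f g : Enumeration) : Prop :=
  Set.EqOn f (g ∘ τ.shift k i) (Set.Iio (τ.m k))

/-- `L k` consists of enumerations of the sets of level `k` of a construction scheme over `X`. -/
structure IsEnumeratedScheme (τ : SchemeType) (X : Set Ordinal.{0})
    (L : ℕ → Set Enumeration) : Prop where
  mapsTo : ∀ {k}, ∀ f ∈ L k, Set.MapsTo f (Set.Iio (τ.m k)) X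
  strictMonoOn : ∀ {k}, ∀ f ∈ L k, StrictMonoOn f (Set.Iio (τ.m k))
  coherent : ∀ {k}, ∀ f ∈ L k, ∀ g ∈ L k, Coherent (τ.m k) f g
  piece_mem : ∀ {k}, ∀ f ∈ L (k + 1), ∀ i < τ.n (k + 1), f ∘ τ.shift k i ∈ L k
  cofinal : ∀ A ∈ FIN X, ∀ N, ∃ k ≥ N, ∃ f ∈ L k, A ⊆ enumSet (τ.m k) f

section

variable {τ : SchemeType} {k l m m' : ℕ} {f g : Enumeration} {x : Ordinal.{0}}
  {X : Set Ordinal.{0}} {L : ℕ → Set Enumeration} {σ σ' : ℕ → ℕ}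

theorem mem_enumSet : x ∈ enumSet m f ↔ ∃ s < m, f s = x := by simp [enumSet]

theorem enumSet_subset_of_eqOn_comp (h : Set.EqOn f (g ∘ σ) (Set.Iio m))
    (hσ : Set.MapsTo σ (Set.Iio m) (Set.Iio m')) : enumSet m f ⊆ enumSet m' g := by
  intro x hx
  obtain ⟨s, hs, rfl⟩ := mem_enumSet.1 hx
  exact mem_enumSet.2 ⟨σ s, hσ hs, (h hs).symm⟩

theorem enumSet_congr (h : Set.EqOn f g (Set.Iio m)) : enumSet m f = enumSet m g :=
  Finset.image_congr fun _ hs => h (Finset.mem_range.1 hs)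

theorem Coherent.symm (h : Coherent m f g) : Coherent m g f := by
  intro a ha b hb e
  obtain ⟨rfl, h'⟩ := h b hb a ha e.symm
  exact ⟨rfl, h'.symm⟩

theorem Coherent.congr_right {g' : Enumeration} (h : Coherent m f g)
    (hg : Set.EqOn g g' (Set.Iio m)) : Coherent m f g' := by
  intro a ha b hb e
  obtain ⟨rfl, h'⟩ := h a ha b hb (e.trans (hg hb).symm)
  exact ⟨rfl, fun c hc => (h' hc).trans (hg (hc.trans_lt ha))⟩

theorem IsPositionMap.coherent_comp (hσ : IsPositionMap τ k l σ) (hσ' : IsPositionMap τ k l σ')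
    (hf : Set.InjOn f (Set.Iio (τ.m l))) : Coherent (τ.m k) (f ∘ σ) (f ∘ σ') := by
  intro a ha b hb hab
  obtain ⟨rfl, h⟩ := hσ.coherent hσ' ha hb (hf (hσ.mapsTo ha) (hσ'.mapsTo hb) hab)
  exact ⟨rfl, fun c hc => congrArg f (h hc)⟩

theorem IsPiece.index_unique {i j : ℕ} (hf : StrictMonoOn g (Set.Iio (τ.m (k + 1))))
    (hi : i < τ.n (k + 1)) (hj : j < τ.n (k + 1)) (h : IsPiece τ k i f g)
    (h' : IsPiece τ k j f g) : i = j := by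
  have hr : τ.r (k + 1) ∈ Set.Iio (τ.m k) := τ.r_lt_m k
  have e := hf.injOn (shift_lt hr hi) (shift_lt hr hj) ((h hr).symm.trans (h' hr))
  exact (shift_eq_shift hr hr e).2.resolve_right (lt_irrefl _)

namespace IsEnumeratedScheme

theorem comp_mem (h : IsEnumeratedScheme τ X L) (hf : f ∈ L l) (hσ : IsPositionMap τ k l σ) :
    f ∘ σ ∈ L k := by
  induction hσ generalizing f with
  | refl => exact hf
  | step _ hi ih => exact ih (h.piece_mem f hf _ hi)

theorem exists_positionMap (h : IsEnumeratedScheme τ X L) (hf : f ∈ L k) (hg : g ∈ L l)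
    (hkl : k ≤ l) (hfg : enumSet (τ.m k) f ⊆ enumSet (τ.m l) g) :
    ∃ σ, IsPositionMap τ k l σ ∧ Set.EqOn f (g ∘ σ) (Set.Iio (τ.m k)) := by
  have hm := τ.m_pos k
  obtain ⟨p, hp, e⟩ := mem_enumSet.1 (hfg (mem_enumSet.2 ⟨τ.m k - 1, by omega, rfl⟩))
  obtain ⟨σ, hσ, q, hq, rfl⟩ := IsPositionMap.exists_apply_eq hkl hp
  obtain ⟨-, heq⟩ := h.coherent f hf _ (h.comp_mem hg hσ) (τ.m k - 1) (by omega) q hq e.symm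
  exact ⟨σ, hσ, fun s hs => heq (Nat.le_sub_one_of_lt hs)⟩

end IsEnumeratedScheme

end

/-! ### Branches -/

/-- The first `a` values of `f`, followed by `b, b + 1, b + 2, …`. -/
noncomputable def graft (b : Ordinal.{0}) (f : Enumeration) (a : ℕ) : Enumeration :=
  fun s => if s < a then f s else b + ((s - a : ℕ) : Ordinal.{0})

/-- `g` enumerates a set of size `m_k` which consists of a proper initial segment of a set of
level `k` of `L`, followed by an initial segment of `[b, b + ω)`. -/
def IsNode (τ : SchemeType) (L : ℕ → Set Enumeration) (b : Ordinal.{0}) (k : ℕ)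
    (g : Enumeration) : Prop :=
  ∃ a < τ.m k, ∃ f, (0 < a → f ∈ L k) ∧ g = graft b f a

/-- `e 0, …, e k` are nodes over the scheme `L` below `b`, each a piece of the next one. -/
structure IsPath (τ : SchemeType) (L : ℕ → Set Enumeration) (b : Ordinal.{0}) (k : ℕ)
    (e : ℕ → Enumeration) : Prop where
  isNode : ∀ j ≤ k, IsNode τ L b j (e j)
  exists_isPiece : ∀ j < k, ∃ i < τ.n (j + 1), IsPiece τ j i (e j) (e (j + 1))

/-- An infinite path over the scheme `L` below `b`, whose sets cover `b + ω`. -/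
structure IsBranch (τ : SchemeType) (L : ℕ → Set Enumeration) (b : Ordinal.{0})
    (e : ℕ → Enumeration) : Prop where
  isPath : ∀ k, IsPath τ L b k e
  cover : ∀ x < b + ω, ∃ k, x ∈ enumSet (τ.m k) (e k)

/-- The sets of level `k` of the scheme over `ω * ξ` generated by the branches `E η`, `η < ξ`. -/
def levelBelow (τ : SchemeType) (E : Ordinal.{0} → ℕ → Enumeration) (ξ : Ordinal.{0}) (k : ℕ) :
    Set Enumeration :=
  {f | ∃ η < ξ, ∃ j σ, IsPositionMap τ k j σ ∧ f = E η j ∘ σ}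

section

variable {τ : SchemeType} {L : ℕ → Set Enumeration} {b : Ordinal.{0}} {k l a s : ℕ}
  {f g : Enumeration} {e : ℕ → Enumeration} {σ : ℕ → ℕ}

theorem graft_of_lt (h : s < a) : graft b f a s = f s := if_pos h

theorem graft_of_le (h : a ≤ s) : graft b f a s = b + ((s - a : ℕ) : Ordinal.{0}) :=
  if_neg h.not_gt

theorem graft_self : graft b f a a = b := by simp [graft]

theorem le_graft (h : a ≤ s) : b ≤ graft b f a s := (graft_of_le h).symm ▸ le_self_add

theorem graft_congr (h : Set.EqOn f g (Set.Iio a)) : graft b f a = graft b g a := by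
  funext s
  unfold graft
  split_ifs with hs
  exacts [h hs, rfl]

namespace IsNode

theorem mapsTo (hL : IsEnumeratedScheme τ (Set.Iio b) L) (h : IsNode τ L b k g) :
    Set.MapsTo g (Set.Iio (τ.m k)) (Set.Iio (b + ω)) := by
  obtain ⟨a, -, f, hf, rfl⟩ := h
  intro s hs
  rcases lt_or_ge s a with hsa | hsa
  · rw [graft_of_lt hsa]
    exact (Set.mem_Iio.1 (hL.mapsTo f (hf (by omega)) hs)).trans_le le_self_add
  · rw [graft_of_le hsa]
    exact (add_lt_add_iff_left _).2 (natCast_lt_omega0 _)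

theorem strictMonoOn (hL : IsEnumeratedScheme τ (Set.Iio b) L) (h : IsNode τ L b k g) :
    StrictMonoOn g (Set.Iio (τ.m k)) := by
  obtain ⟨a, -, f, hf, rfl⟩ := h
  intro s hs s' hs' hss
  rcases lt_or_ge s a with hsa | hsa
  · rw [graft_of_lt hsa]
    have hf := hf (by omega)
    rcases lt_or_ge s' a with hsa' | hsa'
    · rw [graft_of_lt hsa']
      exact hL.strictMonoOn f hf hs hs' hss
    · exact lt_of_lt_of_le (hL.mapsTo f hf hs) (le_graft hsa')
  · rw [graft_of_le hsa, graft_of_le (hsa.trans hss.le)]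
    exact (add_lt_add_iff_left _).2 (Nat.cast_lt.2 (by omega))

theorem coherent (hL : IsEnumeratedScheme τ (Set.Iio b) L) (h : IsNode τ L b l g)
    (hf : f ∈ L k) (hσ : IsPositionMap τ k l σ) : Coherent (τ.m k) f (g ∘ σ) := by
  obtain ⟨a, -, g, hg, rfl⟩ := h
  intro s hs s' hs' hss
  have hlt : σ s' < a := lt_of_not_ge fun hle =>
    (hL.mapsTo f hf hs).not_ge ((le_graft hle).trans_eq hss.symm)
  rw [Function.comp, graft_of_lt hlt] at hss
  obtain ⟨rfl, heq⟩ := hL.coherent f hf _ (hL.comp_mem (hg (by omega)) hσ) s hs s' hs' hss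
  refine ⟨rfl, fun c hc => (heq hc).trans ?_⟩
  exact (graft_of_lt ((hσ.strictMono.monotone hc).trans_lt hlt)).symm

end IsNode

theorem exists_common_positionMap {e' : ℕ → Enumeration} (hkl : k ≤ l)
    (h : ∀ j, k ≤ j → j < l → ∃ i < τ.n (j + 1),
      IsPiece τ j i (e j) (e (j + 1)) ∧ IsPiece τ j i (e' j) (e' (j + 1))) :
    ∃ σ, IsPositionMap τ k l σ ∧ Set.EqOn (e k) (e l ∘ σ) (Set.Iio (τ.m k)) ∧
      Set.EqOn (e' k) (e' l ∘ σ) (Set.Iio (τ.m k)) := by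
  induction l, hkl using Nat.le_induction with
  | base => exact ⟨id, .refl, fun _ _ => rfl, fun _ _ => rfl⟩
  | succ l hkl ih =>
    obtain ⟨σ, hσ, heq, heq'⟩ := ih fun j hj hjl => h j hj (hjl.trans l.lt_succ_self)
    obtain ⟨i, hi, hpiece, hpiece'⟩ := h l hkl l.lt_succ_self
    exact ⟨_, hσ.step hi, fun s hs => (heq hs).trans (hpiece (hσ.mapsTo hs)),
      fun s hs => (heq' hs).trans (hpiece' (hσ.mapsTo hs))⟩

theorem IsPath.exists_positionMap (h : IsPath τ L b l e) (hkl : k ≤ l) :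
    ∃ σ, IsPositionMap τ k l σ ∧ Set.EqOn (e k) (e l ∘ σ) (Set.Iio (τ.m k)) := by
  obtain ⟨σ, hσ, heq, -⟩ := exists_common_positionMap (e := e) (e' := e) hkl fun j _ hjl =>
    (h.exists_isPiece j hjl).imp fun _ ⟨hi, hpiece⟩ => ⟨hi, hpiece, hpiece⟩
  exact ⟨σ, hσ, heq⟩

theorem IsPath.enumSet_subset (h : IsPath τ L b l e) (hkl : k ≤ l) :
    enumSet (τ.m k) (e k) ⊆ enumSet (τ.m l) (e l) := by
  obtain ⟨σ, hσ, heq⟩ := h.exists_positionMap hkl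
  exact enumSet_subset_of_eqOn_comp heq hσ.mapsTo

namespace IsBranch

theorem isNode (h : IsBranch τ L b e) (k : ℕ) : IsNode τ L b k (e k) :=
  (h.isPath k).isNode k le_rfl

theorem exists_isPiece (h : IsBranch τ L b e) (k : ℕ) :
    ∃ i < τ.n (k + 1), IsPiece τ k i (e k) (e (k + 1)) :=
  (h.isPath (k + 1)).exists_isPiece k k.lt_succ_self

theorem exists_forall_subset (h : IsBranch τ L b e) {A : Finset Ordinal.{0}}
    (hA : (A : Set Ordinal.{0}) ⊆ Set.Iio (b + ω)) :
    ∃ k, ∀ l ≥ k, A ⊆ enumSet (τ.m l) (e l) := by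
  have hmono : Monotone fun k => (enumSet (τ.m k) (e k) : Set Ordinal.{0}) := fun _ l hkl =>
    Finset.coe_subset.2 ((h.isPath l).enumSet_subset hkl)
  obtain ⟨k, hk⟩ := hmono.directed_le.exists_mem_subset_of_finset_subset_biUnion (s := A)
    fun x hx => Set.mem_iUnion.2 (h.cover x (hA hx))
  exact ⟨k, fun l hl => Finset.coe_subset.1 (hk.trans (hmono hl))⟩

theorem coherent_comp (hL : IsEnumeratedScheme τ (Set.Iio b) L) (h : IsBranch τ L b e) {j j' : ℕ}
    {σ' : ℕ → ℕ} (hσ : IsPositionMap τ k j σ) (hσ' : IsPositionMap τ k j' σ') :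
    Coherent (τ.m k) (e j ∘ σ) (e j' ∘ σ') := by
  obtain ⟨θ, hθ, heq⟩ := (h.isPath _).exists_positionMap (le_max_left j j')
  obtain ⟨θ', hθ', heq'⟩ := (h.isPath _).exists_positionMap (le_max_right j j')
  have hC := (hσ.comp hθ).coherent_comp (hσ'.comp hθ')
    ((h.isNode (max j j')).strictMonoOn hL).injOn
  exact ((hC.congr_right fun s hs => (heq' (hσ'.mapsTo hs)).symm).symm.congr_right
    fun s hs => (heq (hσ.mapsTo hs)).symm).symm

end IsBranch

end

/-! ### The scheme generated by a sequence of branches -/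

section

variable {τ : SchemeType} {E E' : Ordinal.{0} → ℕ → Enumeration} {η ξ : Ordinal.{0}} {k : ℕ}
  {f g : Enumeration}

theorem mem_levelBelow (h : η < ξ) (k : ℕ) : E η k ∈ levelBelow τ E ξ k :=
  ⟨η, h, k, id, .refl, rfl⟩

theorem levelBelow_congr (h : ∀ η < ξ, E η = E' η) : levelBelow τ E ξ = levelBelow τ E' ξ := by
  ext k f
  refine exists_congr fun η => and_congr_right fun hη => ?_
  rw [h η hη]

theorem exists_subset_Iio_omega_mul_add {A : Finset Ordinal.{0}}
    (hA : A ∈ FIN (Set.Iio (ω * ξ))) :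
    ∃ η < ξ, (A : Set Ordinal.{0}) ⊆ Set.Iio (ω * η + ω) := by
  refine ⟨A.max' hA.1 / ω, (lt_mul_iff_div_lt omega0_ne_zero).1 (hA.2 (A.max'_mem hA.1)),
    fun x hx => (A.le_max' x hx).trans_lt ?_⟩
  simpa only [Order.succ_eq_add_one, mul_add, mul_one] using
    lt_mul_succ_div (A.max' hA.1) omega0_ne_zero

theorem omega_mul_add_omega_le (h : η < ξ) : ω * η + ω ≤ ω * ξ := by
  simpa [mul_add] using mul_le_mul_right (Order.add_one_le_of_lt h) ω

theorem coherent_levelBelow_of_lt (hL : IsEnumeratedScheme τ (Set.Iio (ω * ξ)) (levelBelow τ E ξ))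
    (hE : IsBranch τ (levelBelow τ E ξ) (ω * ξ) (E ξ)) {j j' : ℕ} {σ σ' : ℕ → ℕ} (hη : η < ξ)
    (hσ : IsPositionMap τ k j σ) (hσ' : IsPositionMap τ k j' σ') :
    Coherent (τ.m k) (E η j ∘ σ) (E ξ j' ∘ σ') :=
  (hE.isNode j').coherent hL (hL.comp_mem (mem_levelBelow hη j) hσ) hσ'

theorem isEnumeratedScheme_levelBelow
    (h : ∀ η < ξ, IsBranch τ (levelBelow τ E η) (ω * η) (E η)) :
    IsEnumeratedScheme τ (Set.Iio (ω * ξ)) (levelBelow τ E ξ) := by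
  induction ξ using WellFoundedLT.induction with
  | _ ξ ih =>
    replace ih η (hη : η < ξ) := ih η hη fun ζ hζ => h ζ (hζ.trans hη)
    refine ⟨?_, ?_, ?_, ?_, ?_⟩
    · rintro k _ ⟨η, hη, j, σ, hσ, rfl⟩ s hs
      exact (((h η hη).isNode j).mapsTo (ih η hη) (hσ.mapsTo hs)).trans_le
        (omega_mul_add_omega_le hη)
    · rintro k _ ⟨η, hη, j, σ, hσ, rfl⟩
      exact (((h η hη).isNode j).strictMonoOn (ih η hη)).comp (hσ.strictMono.strictMonoOn _)
        hσ.mapsTo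
    · rintro k _ ⟨η, hη, j, σ, hσ, rfl⟩ _ ⟨ζ, hζ, j', σ', hσ', rfl⟩
      rcases lt_trichotomy η ζ with hlt | rfl | hlt
      · exact coherent_levelBelow_of_lt (ih ζ hζ) (h ζ hζ) hlt hσ hσ'
      · exact (h η hη).coherent_comp (ih η hη) hσ hσ'
      · exact (coherent_levelBelow_of_lt (ih η hη) (h η hη) hlt hσ' hσ).symm
    · rintro k _ ⟨η, hη, j, σ, hσ, rfl⟩ i hi
      exact ⟨η, hη, j, _, (IsPositionMap.refl.step hi).comp hσ, rfl⟩
    · intro A hA N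
      obtain ⟨η, hη, hAη⟩ := exists_subset_Iio_omega_mul_add hA
      obtain ⟨k, hk⟩ := (h η hη).exists_forall_subset hAη
      exact ⟨max k N, le_max_right _ _, _, mem_levelBelow hη _, hk _ (le_max_left _ _)⟩

end

/-! ### Extending finite paths -/

section

variable {τ : SchemeType} {L : ℕ → Set Enumeration} {b : Ordinal.{0}} {k v a i : ℕ}
  {e e' : ℕ → Enumeration} {f g : Enumeration} {σ : ℕ → ℕ}

theorem isPiece_zero_iff : IsPiece τ k 0 f g ↔ Set.EqOn f g (Set.Iio (τ.m k)) := by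
  simp [IsPiece, Set.EqOn]

theorem graft_comp_shift (h : i = 0 ∨ τ.r (k + 1) ≤ a) :
    graft b f (a + i * (τ.m k - τ.r (k + 1))) ∘ τ.shift k i = graft b (f ∘ τ.shift k i) a := by
  funext s
  rcases lt_or_ge s a with hs | hs
  · have : τ.shift k i s < a + i * (τ.m k - τ.r (k + 1)) := by
      unfold SchemeType.shift
      split_ifs <;> omega
    rw [Function.comp, graft_of_lt this, graft_of_lt hs, Function.comp]
  · have : τ.shift k i s = s + i * (τ.m k - τ.r (k + 1)) := by
      rcases h with rfl | h
      · simp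
      · exact shift_of_le (h.trans hs)
    rw [Function.comp, graft_of_le hs, this, graft_of_le (by omega), Nat.add_sub_add_right]

theorem isPiece_graft {a' : ℕ} (ha : a < τ.m k) (hia : i = 0 ∨ τ.r (k + 1) ≤ a)
    (ha' : a' = a + i * (τ.m k - τ.r (k + 1))) (h : IsPiece τ k i f g) :
    IsPiece τ k i (graft b f a) (graft b g a') := by
  intro s _
  rw [ha', graft_comp_shift hia, graft_congr fun s hs => h (lt_trans hs ha)]

theorem add_mul_lt_m_succ (ha : a < τ.m k) (hi : i < τ.n (k + 1)) :
    a + i * (τ.m k - τ.r (k + 1)) < τ.m (k + 1) := by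
  have hr := τ.r_lt_m k
  have : (i + 1) * (τ.m k - τ.r (k + 1)) ≤ τ.n (k + 1) * (τ.m k - τ.r (k + 1)) :=
    Nat.mul_le_mul_right _ hi
  rw [τ.m_succ, mul_comm (τ.m k - _)]
  rw [add_mul] at this
  omega

theorem IsBranch.index_eq_zero (hL : IsEnumeratedScheme τ (Set.Iio b) L) (h : IsBranch τ L b e)
    {c : ℕ} (hc : c < τ.r (k + 1)) (hcb : e k c = b) (hpiece : IsPiece τ k i (e k) (e (k + 1))) :
    i = 0 := by
  have hr := τ.r_lt_m k
  have hm : τ.m k < τ.m (k + 1) := m_strictMono k.lt_succ_self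
  have hinj (j) := ((h.isNode j).strictMonoOn hL).injOn
  obtain ⟨a, ha, f, -, hk⟩ := h.isNode k
  obtain ⟨a', ha', f', -, hk'⟩ := h.isNode (k + 1)
  obtain rfl : a = c := hinj k ha (hc.trans hr) (by rw [hcb, hk, graft_self])
  obtain rfl : a' = a := hinj (k + 1) ha' (ha.trans hm) (by
    rw [← shift_of_lt (τ := τ) (i := i) hc, ← Function.comp_apply (f := e (k + 1)), ← hpiece ha,
      hcb, hk', graft_self])
  have heq := hpiece hr
  rw [hk, hk', Function.comp, shift_of_le le_rfl, graft_of_le hc.le, graft_of_le (by omega),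
    add_right_inj, Nat.cast_inj] at heq
  have : i * (τ.m k - τ.r (k + 1)) = 0 := by omega
  exact (mul_eq_zero.1 this).resolve_right (Nat.sub_pos_of_lt hr).ne'

namespace IsPath

theorem of_eqOn (h : IsPath τ L b v e) (hkv : k ≤ v) (he : Set.EqOn e' e (Set.Iic k)) :
    IsPath τ L b k e' where
  isNode j hj := he hj ▸ h.isNode j (hj.trans hkv)
  exists_isPiece j hj := by
    rw [he hj.le, he (Set.mem_Iic.2 hj)]
    exact h.exists_isPiece j (hj.trans_le hkv)

theorem update (h : IsPath τ L b k e) (hg : IsNode τ L b (k + 1) g) (hi : i < τ.n (k + 1))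
    (hpiece : IsPiece τ k i (e k) g) : IsPath τ L b (k + 1) (Function.update e (k + 1) g) := by
  have hne {j} (hj : j ≤ k) : Function.update e (k + 1) g j = e j :=
    Function.update_of_ne (by omega) ..
  refine ⟨fun j hj => ?_, fun j hj => ?_⟩
  · rcases hj.eq_or_lt with rfl | hj
    · rwa [Function.update_self]
    · rw [hne (by omega)]
      exact h.isNode j (by omega)
  · rcases (Nat.lt_succ_iff.1 hj).eq_or_lt with rfl | hj
    · rw [hne le_rfl, Function.update_self]
      exact ⟨i, hi, hpiece⟩
    · rw [hne hj.le, hne hj]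
      exact h.exists_isPiece j hj

/-- The new set enlarges the `i`-th piece of the set `f`; for `i ≠ 0` this requires that the path
already contains the root of `f`. -/
theorem exists_succ (h : IsPath τ L b k e) (ha : a < τ.m k) (hf : f ∈ L (k + 1))
    (hi : i < τ.n (k + 1)) (hia : i = 0 ∨ τ.r (k + 1) ≤ a)
    (he : e k = graft b (f ∘ τ.shift k i) a) :
    ∃ e', IsPath τ L b (k + 1) e' ∧ Set.EqOn e' e (Set.Iic k) ∧
      e' (k + 1) = graft b f (a + i * (τ.m k - τ.r (k + 1))) := by
  refine ⟨Function.update e (k + 1) (graft b f (a + i * (τ.m k - τ.r (k + 1)))),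
    h.update ⟨_, add_mul_lt_m_succ ha hi, f, fun _ => hf, rfl⟩ hi fun s _ => ?_,
    fun j hj => Function.update_of_ne (Nat.lt_succ_of_le hj).ne .., Function.update_self ..⟩
  rw [graft_comp_shift hia, he]

theorem exists_graft_of_positionMap (hL : ∀ j, ∀ f ∈ L (j + 1), ∀ i < τ.n (j + 1),
    f ∘ τ.shift j i ∈ L j) (h : IsPath τ L b k e) (ha : a < τ.m k) (hσ : IsPositionMap τ k v σ)
    (hf : f ∈ L v) (he : e k = graft b (f ∘ σ) a) :
    ∃ e', IsPath τ L b v e' ∧ Set.EqOn e' e (Set.Iic k) ∧ ∃ a' < τ.m v, e' v = graft b f a' := by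
  induction hσ generalizing f with
  | refl => exact ⟨e, h, fun _ _ => rfl, a, ha, he⟩
  | @step v i σ hσ hi ih =>
    obtain ⟨e₁, h₁, heq₁, a₁, ha₁, he₁⟩ := ih (hL v f hf i hi) he
    suffices ∃ i < τ.n (v + 1), (i = 0 ∨ τ.r (v + 1) ≤ a₁) ∧
        e₁ v = graft b (f ∘ τ.shift v i) a₁ by
      obtain ⟨i, hi, hia, he₁⟩ := this
      obtain ⟨e₂, h₂, heq₂, he₂⟩ := h₁.exists_succ ha₁ hf hi hia he₁
      exact ⟨e₂, h₂, fun j hj => (heq₂ (hj.trans hσ.le)).trans (heq₁ hj), _,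
        add_mul_lt_m_succ ha₁ hi, he₂⟩
    rcases le_or_gt (τ.r (v + 1)) a₁ with hr | hr
    · exact ⟨i, hi, .inr hr, he₁⟩
    · refine ⟨0, τ.n_pos v, .inl rfl, he₁.trans (graft_congr fun s hs => ?_)⟩
      rw [Function.comp, Function.comp, shift_zero, shift_of_lt (lt_trans hs hr)]

theorem exists_graft_of_isPiece {g : ℕ → Enumeration} {a i : ℕ → ℕ} (h : IsPath τ L b k e)
    (hkv : k ≤ v) (hg : ∀ j, g j ∈ L j) (hi : ∀ j, i j < τ.n (j + 1))
    (hpiece : ∀ j, k ≤ j → j < v → IsPiece τ j (i j) (g j) (g (j + 1)))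
    (hia : ∀ j, k ≤ j → j < v → i j = 0 ∨ τ.r (j + 1) ≤ a j)
    (ha : a k < τ.m k) (ha' : ∀ j, k ≤ j → a (j + 1) = a j + i j * (τ.m j - τ.r (j + 1)))
    (he : e k = graft b (g k) (a k)) :
    ∃ e', IsPath τ L b v e' ∧ Set.EqOn e' e (Set.Iic k) ∧
      ∀ j, k ≤ j → j ≤ v → e' j = graft b (g j) (a j) := by
  have hlt j (hj : k ≤ j) : a j < τ.m j := by
    induction j, hj using Nat.le_induction with
    | base => exact ha
    | succ j hj ih => exact ha' j hj ▸ add_mul_lt_m_succ ih (hi j)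
  induction v, hkv using Nat.le_induction with
  | base => exact ⟨e, h, fun _ _ => rfl, fun j hkj hjk => le_antisymm hkj hjk ▸ he⟩
  | succ v hkv ih =>
    obtain ⟨e₁, h₁, heq₁, he₁⟩ := ih (fun j hkj hjv => hpiece j hkj (hjv.trans v.lt_succ_self))
      fun j hkj hjv => hia j hkj (hjv.trans v.lt_succ_self)
    obtain ⟨e₂, h₂, heq₂, he₂⟩ := h₁.exists_succ (hlt v hkv) (hg (v + 1)) (hi v)
      (hia v hkv v.lt_succ_self) ((he₁ v hkv le_rfl).trans <| graft_congr fun s hs =>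
        hpiece v hkv v.lt_succ_self (lt_trans hs (hlt v hkv)))
    refine ⟨e₂, h₂, fun j hj => (heq₂ (hj.trans hkv)).trans (heq₁ hj), fun j hkj hjv => ?_⟩
    rcases hjv.eq_or_lt with rfl | hjv
    · rw [he₂, ha' v hkv]
    · rw [heq₂ (Nat.lt_succ_iff.1 hjv), he₁ j hkj (Nat.lt_succ_iff.1 hjv)]

theorem exists_graft_of_isPiece_zero {g : ℕ → Enumeration} (h : IsPath τ L b k e) (hkv : k ≤ v)
    (hg : ∀ j, g j ∈ L j) (hpiece : ∀ j, k ≤ j → j < v → IsPiece τ j 0 (g j) (g (j + 1)))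
    (ha : a < τ.m k) (he : e k = graft b (g k) a) :
    ∃ e', IsPath τ L b v e' ∧ Set.EqOn e' e (Set.Iic k) ∧
      ∀ j, k ≤ j → j ≤ v → e' j = graft b (g j) a :=
  h.exists_graft_of_isPiece (a := fun _ => a) (i := fun _ => 0) hkv hg (fun j => τ.n_pos j) hpiece
    (fun _ _ _ => .inl rfl) ha (fun _ _ => by simp) he

end IsPath

end

/-! ### Generic branches -/

/-- The copy, in the `i`-th piece of the set of level `k + 1` enumerated by `h`, of the set of
positions `t`. -/
noncomputable def copyOf (τ : SchemeType) (k : ℕ) (h : Enumeration) (t : Finset ℕ) (i : ℕ) :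
    Finset Ordinal.{0} :=
  t.image fun s => h (τ.shift k i s)

/-- From level `u` to level `v` the sets of `e` only grow by end-extension, while every `c ≤ m_u`
occurs as some `r_l` with `l ∈ P`. -/
def IsIdle (τ : SchemeType) (P : Set ℕ) (e : ℕ → Enumeration) (u v : ℕ) : Prop :=
  (∀ c ≤ τ.m u, ∃ l ∈ P, u < l ∧ l ≤ v ∧ τ.r l = c) ∧
    ∀ j, u ≤ j → j < v → IsPiece τ j 0 (e j) (e (j + 1))

/-- At level `k` the path `e` below `b` first leaves `b`, as the `j`-th piece of a set whose
earlier pieces contain copies of `t` in `S`; the number `j` of these copies is as large as it can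
be for a set of level `k + 1` of `L` with the same root. -/
structure IsMaximalCapture (τ : SchemeType) (L : ℕ → Set Enumeration)
    (S : Set (Finset Ordinal.{0})) (b : Ordinal.{0}) (e : ℕ → Enumeration) (k : ℕ) (t : Finset ℕ)
    (j : ℕ) : Prop where
  lt : j < τ.n (k + 1)
  base : e k (τ.r (k + 1)) = b
  piece : IsPiece τ k j (e k) (e (k + 1))
  mem : ∀ i < j, copyOf τ k (e (k + 1)) t i ∈ S
  max : ∀ q < τ.n (k + 1), ∀ H ∈ L (k + 1), Set.EqOn H (e k) (Set.Iio (τ.r (k + 1))) →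
    (∀ i < q, copyOf τ k H t i ∈ S) → q ≤ j

/-- At some level `k ≥ N` with `k + 1 ∈ P`, the set `A` has positions `t` in `e k`, which is the
`j`-th piece of `e (k + 1)` for some `t` and `j` with `C k t j`. -/
def Realizes (τ : SchemeType) (C : ℕ → Finset ℕ → ℕ → Prop) (P : Set ℕ) (e : ℕ → Enumeration)
    (A : Finset Ordinal.{0}) (N : ℕ) : Prop :=
  ∃ k ≥ N, k + 1 ∈ P ∧ ∃ t ⊆ Finset.range (τ.m k), t.image (e k) = A ∧
    ∃ j, C k t j ∧ IsPiece τ k j (e k) (e (k + 1))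

/-- A branch over the scheme generated by `E η`, `η < ξ`, which has long idle intervals and which
realizes all its finite subsets according to the maximal captures of each `E η` (with respect to
the guess `S η`) and of itself. -/
structure IsGenericBranch (τ : SchemeType) (𝒬 : Set (Set ℕ))
    (S : Ordinal.{0} → Set (Finset Ordinal.{0})) (E : Ordinal.{0} → ℕ → Enumeration)
    (ξ : Ordinal.{0}) (e : ℕ → Enumeration) : Prop
    extends IsBranch τ (levelBelow τ E ξ) (ω * ξ) e where
  idle : ∀ P ∈ 𝒬, ∀ N, ∃ u ≥ N, ∃ v ≥ u + N, IsIdle τ P e u v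
  realizes_earlier : ∀ η, 0 < η → η < ξ → ∀ A : Finset Ordinal.{0},
    (A : Set Ordinal.{0}) ⊆ Set.Iio (ω * ξ + ω) → ∀ P ∈ 𝒬, ∀ N,
      Realizes τ (IsMaximalCapture τ (levelBelow τ E η) (S η) (ω * η) (E η)) P e A N
  realizes_self : 0 < ξ → ∀ A : Finset Ordinal.{0},
    (A : Set Ordinal.{0}) ⊆ Set.Iio (ω * ξ + ω) → ∀ P ∈ 𝒬, ∀ N,
      Realizes τ (IsMaximalCapture τ (levelBelow τ E ξ) (S ξ) (ω * ξ) e) P e A N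

theorem IsGenericBranch.realizes {τ : SchemeType} {𝒬 : Set (Set ℕ)}
    {S : Ordinal.{0} → Set (Finset Ordinal.{0})} {E : Ordinal.{0} → ℕ → Enumeration}
    {ξ η : Ordinal.{0}} (h : IsGenericBranch τ 𝒬 S E ξ (E ξ)) (hη : 0 < η) (hηξ : η ≤ ξ)
    {A : Finset Ordinal.{0}} (hA : (A : Set Ordinal.{0}) ⊆ Set.Iio (ω * ξ + ω)) {P : Set ℕ}
    (hP : P ∈ 𝒬) (N : ℕ) :
    Realizes τ (IsMaximalCapture τ (levelBelow τ E η) (S η) (ω * η) (E η)) P (E ξ) A N := by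
  rcases hηξ.eq_or_lt with rfl | hlt
  · exact h.realizes_self hη A hA P hP N
  · exact h.realizes_earlier η hη hlt A hA P hP N

theorem exists_image_eq {m : ℕ} {f : Enumeration} {A : Finset Ordinal.{0}} (h : A ⊆ enumSet m f) :
    ∃ t ⊆ Finset.range m, t.image f = A :=
  Finset.subset_image_iff.1 h

theorem Realizes.subset {τ : SchemeType} {C : ℕ → Finset ℕ → ℕ → Prop} {P : Set ℕ}
    {e : ℕ → Enumeration} {A : Finset Ordinal.{0}} {N : ℕ} (h : Realizes τ C P e A N) :
    ∃ k, A ⊆ enumSet (τ.m k) (e k) := by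
  obtain ⟨k, -, -, t, ht, rfl, -⟩ := h
  exact ⟨k, Finset.image_subset_image ht⟩

/-! ### Following an earlier branch -/

section

variable {τ : SchemeType} {𝒬 : Set (Set ℕ)} {S : Ordinal.{0} → Set (Finset Ordinal.{0})}
  {E : Ordinal.{0} → ℕ → Enumeration} {ξ γ γ₀ x : Ordinal.{0}} {k v a : ℕ}
  {e : ℕ → Enumeration} {P : Set ℕ}

namespace IsPath

theorem exists_track (hE : ∀ η < ξ, IsBranch τ (levelBelow τ E η) (ω * η) (E η)) (hγ₀ : γ₀ < ξ)
    (h : IsPath τ (levelBelow τ E ξ) (ω * ξ) k e) (hx : x < ω * ξ) :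
    ∃ γ < ξ, γ₀ ≤ γ ∧ ∃ u₀ ≥ k, ∀ u ≥ u₀, x ∈ enumSet (τ.m u) (E γ u) ∧
      ∃ e', IsPath τ (levelBelow τ E ξ) (ω * ξ) u e' ∧ Set.EqOn e' e (Set.Iic k) ∧
        ∃ a < τ.m u, e' u = graft (ω * ξ) (E γ u) a := by
  have hL := isEnumeratedScheme_levelBelow hE
  obtain ⟨a, ha, f, hf, hek⟩ : ∃ a < τ.m k, ∃ f ∈ levelBelow τ E ξ k, e k = graft (ω * ξ) f a := by
    obtain ⟨a, ha, f, hf, hek⟩ := h.isNode k le_rfl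
    rcases a.eq_zero_or_pos with rfl | hpos
    · exact ⟨0, ha, E γ₀ k, mem_levelBelow hγ₀ k, hek.trans (graft_congr fun s hs => by simp at hs)⟩
    · exact ⟨a, ha, f, hf hpos, hek⟩
  have hfx : insert x (enumSet (τ.m k) f) ∈ FIN (Set.Iio (ω * ξ)) := by
    refine ⟨Finset.insert_nonempty .., ?_⟩
    simp only [Finset.coe_insert, Set.insert_subset_iff, enumSet, Finset.coe_image,
      Finset.coe_range]
    exact ⟨hx, (hL.mapsTo f hf).image_subset⟩
  obtain ⟨γ₁, hγ₁, hsub⟩ := exists_subset_Iio_omega_mul_add hfx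
  have hγ : max γ₀ γ₁ < ξ := max_lt hγ₀ hγ₁
  obtain ⟨u₀, hu₀⟩ := (hE _ hγ).exists_forall_subset (hsub.trans (Set.Iio_subset_Iio
    (add_le_add_left (mul_le_mul_right (le_max_right γ₀ γ₁) ω) ω)))
  refine ⟨_, hγ, le_max_left _ _, max k u₀, le_max_left _ _, fun u hu => ?_⟩
  obtain ⟨hxu, hfu⟩ := Finset.insert_subset_iff.1 (hu₀ u (le_of_max_le_right hu))
  obtain ⟨σ, hσ, hfσ⟩ :=
    hL.exists_positionMap hf (mem_levelBelow hγ u) (le_of_max_le_left hu) hfu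
  exact ⟨hxu, h.exists_graft_of_positionMap (fun _ f hf i hi => hL.piece_mem f hf i hi) ha hσ
    (mem_levelBelow hγ u) (hek.trans (graft_congr fun s hs => hfσ (lt_trans hs ha)))⟩

theorem exists_isIdle (hE : ∀ η < ξ, IsGenericBranch τ 𝒬 S E η (E η)) (hγ₀ : γ₀ < ξ)
    (h : IsPath τ (levelBelow τ E ξ) (ω * ξ) k e) (hx : x < ω * ξ) (hP : P ∈ 𝒬) (N : ℕ) :
    ∃ γ < ξ, γ₀ ≤ γ ∧ ∃ u ≥ max N k, ∃ v ≥ u + N, IsIdle τ P (E γ) u v ∧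
      x ∈ enumSet (τ.m u) (E γ u) ∧
      ∃ e' a, a < τ.m u ∧ IsPath τ (levelBelow τ E ξ) (ω * ξ) v e' ∧ Set.EqOn e' e (Set.Iic k) ∧
        ∀ j, u ≤ j → j ≤ v → e' j = graft (ω * ξ) (E γ j) a := by
  obtain ⟨γ, hγ, hγγ, u₀, hku₀, htrack⟩ := h.exists_track (fun η hη => (hE η hη).toIsBranch) hγ₀ hx
  obtain ⟨u, hu, v, hv, hidle⟩ := (hE γ hγ).idle P hP (max N u₀)
  have hN := le_max_left N u₀
  have hu₀ := le_max_right N u₀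
  obtain ⟨hxu, e₁, h₁, heq₁, a, ha, he₁⟩ := htrack u (hu₀.trans hu)
  obtain ⟨e₂, h₂, heq₂, he₂⟩ := h₁.exists_graft_of_isPiece_zero (by omega : u ≤ v)
    (mem_levelBelow hγ) hidle.2 ha he₁
  exact ⟨γ, hγ, hγγ, u, by omega, v, by omega, hidle, hxu, e₂, a, ha, h₂,
    fun j hj => (heq₂ (Set.mem_Iic.2 (by grind))).trans (heq₁ hj), he₂⟩

/-- After an idle interval up to a level whose next root is the part of the path below `ω * ξ`,
the path is continued as piece `1`, so that the set `E γ l`, which contains `ω * γ`, gets absorbed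
in piece `0`. -/
theorem exists_attach (hE : ∀ η < ξ, IsGenericBranch τ 𝒬 S E η (E η)) (hγ₀ : γ₀ < ξ)
    (h : IsPath τ (levelBelow τ E ξ) (ω * ξ) k e) (hx : x < ω * ξ) (hP : P ∈ 𝒬) :
    ∃ γ < ξ, γ₀ ≤ γ ∧ ∃ u > k, ∃ e', IsPath τ (levelBelow τ E ξ) (ω * ξ) u e' ∧
      Set.EqOn e' e (Set.Iic k) ∧ x ∈ enumSet (τ.m u) (e' u) ∧
      ∃ a < τ.m u, e' u = graft (ω * ξ) (E γ u) a ∧ ∃ c < a, E γ u c = ω * γ := by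
  obtain ⟨γ, hγ, hγγ, u, hu, v, -, hidle, hxu, e₁, a, ha, h₁, heq₁, he₁⟩ :=
    h.exists_isIdle hE hγ₀ hx hP 0
  obtain ⟨l, -, hul, hlv, rfl⟩ := hidle.1 a ha.le
  obtain ⟨l, rfl⟩ := Nat.exists_eq_succ_of_ne_zero (Nat.ne_zero_of_lt hul)
  replace hul : u ≤ l := Nat.lt_succ_iff.1 hul
  have hr := τ.r_lt_m l
  have hEl := isPiece_zero_iff.1 (hidle.2 l hul hlv)
  have hbranch := (hE γ hγ).toIsBranch
  obtain ⟨e₂, h₂, heq₂, he₂⟩ := (h₁.of_eqOn (Nat.le_of_lt hlv) fun _ _ => rfl).exists_succ hr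
    (mem_levelBelow hγ (l + 1)) (τ.two_le_n l) (.inr le_rfl) (by
      rw [he₁ l hul (Nat.le_of_lt hlv)]
      refine graft_congr fun s (hs : s < τ.r (l + 1)) => ?_
      rw [Function.comp, shift_of_lt hs, hEl (hs.trans hr)])
  rw [one_mul, Nat.add_sub_cancel' hr.le] at he₂
  refine ⟨γ, hγ, hγγ, l + 1, by omega, e₂, h₂,
    fun j (hj : j ≤ k) => (heq₂ (show j ≤ l by omega)).trans (heq₁ hj), ?_,
    τ.m l, m_strictMono l.lt_succ_self, he₂, ?_⟩
  · refine enumSet_subset_of_eqOn_comp (f := E γ l) (σ := id) (fun s hs => ?_)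
      (fun s hs => lt_trans hs (m_strictMono l.lt_succ_self))
      ((hbranch.isPath l).enumSet_subset hul hxu)
    rw [he₂, Function.comp, id, graft_of_lt hs, hEl hs]
  · obtain ⟨c, hc, f, -, hcf⟩ := hbranch.isNode l
    exact ⟨c, hc, by rw [← hEl hc, hcf, graft_self]⟩

theorem exists_copy (hE : ∀ η < ξ, IsBranch τ (levelBelow τ E η) (ω * η) (E η)) (hγ : γ < ξ)
    (h : IsPath τ (levelBelow τ E ξ) (ω * ξ) k e) (ha : a < τ.m k)
    (he : e k = graft (ω * ξ) (E γ k) a) {c : ℕ} (hc : c < a) (hcγ : E γ k c = ω * γ)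
    (hkv : k ≤ v) :
    ∃ e', IsPath τ (levelBelow τ E ξ) (ω * ξ) v e' ∧ Set.EqOn e' e (Set.Iic k) ∧
      ∀ j, k ≤ j → j < v → ∀ i < τ.n (j + 1),
        IsPiece τ j i (E γ j) (E γ (j + 1)) → IsPiece τ j i (e' j) (e' (j + 1)) := by
  have hLγ := isEnumeratedScheme_levelBelow fun η hη => hE η (hη.trans hγ)
  choose i hi hpiece using (hE γ hγ).exists_isPiece
  let d j := i j * (τ.m j - τ.r (j + 1))
  let a' j := a + ∑ l ∈ Finset.Ico k j, d l
  have ha' j (hj : k ≤ j) : a' (j + 1) = a' j + d j := by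
    simp only [a', Finset.sum_Ico_succ_top hj, add_assoc]
  have hbase j (hj : k ≤ j) : a' j < τ.m j ∧ ∃ c < a' j, E γ j c = ω * γ := by
    induction j, hj using Nat.le_induction with
    | base => exact ⟨by simpa [a'], c, by simpa [a'], hcγ⟩
    | succ j hj ih =>
      obtain ⟨haj, c, hca, hcj⟩ := ih
      rw [ha' j hj]
      refine ⟨add_mul_lt_m_succ haj (hi j), τ.shift j (i j) c, ?_,
        (hpiece j (hca.trans haj)).symm.trans hcj⟩
      simp only [d, SchemeType.shift]
      split_ifs <;> omega
  have hia j (hj : k ≤ j) : i j = 0 ∨ τ.r (j + 1) ≤ a' j := by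
    obtain ⟨-, c, hca, hcj⟩ := hbase j hj
    by_cases hcr : c < τ.r (j + 1)
    · exact .inl ((hE γ hγ).index_eq_zero hLγ hcr hcj (hpiece j))
    · exact .inr ((not_lt.1 hcr).trans hca.le)
  obtain ⟨e', h', heq, he'⟩ := h.exists_graft_of_isPiece (a := a') hkv (mem_levelBelow hγ) hi
    (fun j _ _ => hpiece j) (fun j hj _ => hia j hj) (by simpa [a']) ha' (by simpa [a'])
  refine ⟨e', h', heq, fun j hj hjv i' hi' hpiece' => ?_⟩
  obtain rfl := (hpiece j).index_unique (((hE γ hγ).isNode (j + 1)).strictMonoOn hLγ) (hi j) hi'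
    hpiece'
  rw [he' j hj hjv.le, he' (j + 1) (hj.trans j.le_succ) hjv]
  exact isPiece_graft (hbase j hj).1 (hia j hj) (ha' j hj) (hpiece j)

theorem exists_mem (hE : ∀ η < ξ, IsGenericBranch τ 𝒬 S E η (E η)) (hξ : 0 < ξ)
    (h𝒬 : 𝒬.Nonempty) (h : IsPath τ (levelBelow τ E ξ) (ω * ξ) k e) (hx : x < ω * ξ + ω) :
    ∃ k' ≥ k, ∃ e', IsPath τ (levelBelow τ E ξ) (ω * ξ) k' e' ∧ Set.EqOn e' e (Set.Iic k) ∧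
      x ∈ enumSet (τ.m k') (e' k') := by
  obtain ⟨P, hP⟩ := h𝒬
  rcases lt_or_ge x (ω * ξ) with hlt | hle
  · obtain ⟨-, -, -, u, hu, e', h', heq, hx', -⟩ := h.exists_attach hE hξ hlt hP
    exact ⟨u, hu.le, e', h', heq, hx'⟩
  · obtain ⟨y, rfl⟩ := exists_add_of_le hle
    obtain ⟨n, rfl⟩ := lt_omega0.1 ((add_lt_add_iff_left _).1 hx)
    obtain ⟨γ, -, -, u, hu, v, hv, -, -, e', a, ha, h', heq, he'⟩ :=
      h.exists_isIdle hE hξ (mul_pos omega0_pos hξ) hP n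
    refine ⟨v, by omega, e', h', heq, mem_enumSet.2 ⟨a + n, ?_, ?_⟩⟩
    · have : (v - u) + τ.m u ≤ τ.m ((v - u) + u) := m_strictMono.add_le_nat ..
      rw [Nat.sub_add_cancel (by omega)] at this
      omega
    · rw [he' v (by omega) le_rfl, graft_of_le (by omega), Nat.add_sub_cancel_left]

theorem exists_subset (hE : ∀ η < ξ, IsGenericBranch τ 𝒬 S E η (E η)) (hξ : 0 < ξ)
    (h𝒬 : 𝒬.Nonempty) (h : IsPath τ (levelBelow τ E ξ) (ω * ξ) k e) {A : Finset Ordinal.{0}}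
    (hA : (A : Set Ordinal.{0}) ⊆ Set.Iio (ω * ξ + ω)) :
    ∃ k' ≥ k, ∃ e', IsPath τ (levelBelow τ E ξ) (ω * ξ) k' e' ∧ Set.EqOn e' e (Set.Iic k) ∧
      A ⊆ enumSet (τ.m k') (e' k') := by
  induction A using Finset.induction_on with
  | empty => exact ⟨k, le_rfl, e, h, fun _ _ => rfl, Finset.empty_subset _⟩
  | insert x A _ ih =>
    rw [Finset.coe_insert, Set.insert_subset_iff] at hA
    obtain ⟨k₁, hk₁, e₁, h₁, heq₁, hA₁⟩ := ih hA.2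
    obtain ⟨k₂, hk₂, e₂, h₂, heq₂, hx⟩ := h₁.exists_mem hE hξ h𝒬 hA.1
    refine ⟨k₂, le_trans hk₁ hk₂, e₂, h₂, fun j hj => ?_, Finset.insert_subset hx ?_⟩
    · exact (heq₂ (le_trans hj hk₁)).trans (heq₁ hj)
    · rw [← heq₂ Set.self_mem_Iic] at hA₁
      exact hA₁.trans (h₂.enumSet_subset hk₂)

end IsPath

end

/-! ### Generic sequences -/

/-- Every finite sequence `e 0, …, e k` satisfying `V` has a proper extension satisfying `V`, all
of whose infinite extensions satisfy `R`. -/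
def IsSecurable {β : Type*} (V : ℕ → (ℕ → β) → Prop) (R : (ℕ → β) → Prop) : Prop :=
  ∀ k e, V k e → ∃ k' > k, ∃ e', V k' e' ∧ Set.EqOn e' e (Set.Iic k) ∧
    ∀ e'', Set.EqOn e'' e' (Set.Iic k') → R e''

theorem exists_generic {β : Type*} {V : ℕ → (ℕ → β) → Prop} {𝓡 : Set ((ℕ → β) → Prop)}
    {e₀ : ℕ → β} (hV : ∀ {k e e'}, V k e → Set.EqOn e' e (Set.Iic k) → V k e') (h₀ : V 0 e₀)
    (h𝓡 : 𝓡.Countable) (hne : 𝓡.Nonempty) (h : ∀ R ∈ 𝓡, IsSecurable V R) :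
    ∃ e, (∀ R ∈ 𝓡, R e) ∧ ∀ k, ∃ k' ≥ k, V k' e := by
  obtain ⟨R, rfl⟩ := h𝓡.exists_eq_range hne
  obtain ⟨q, hlt, heq, hR⟩ : ∃ q : ℕ → {x : ℕ × (ℕ → β) // V x.1 x.2},
      (∀ n, (q n).1.1 < (q (n + 1)).1.1) ∧
      (∀ n, Set.EqOn (q (n + 1)).1.2 (q n).1.2 (Set.Iic (q n).1.1)) ∧
      ∀ n e, Set.EqOn e (q (n + 1)).1.2 (Set.Iic (q (n + 1)).1.1) → R n e := by
    choose K hK F hF heq hR using fun n => h (R n) ⟨n, rfl⟩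
    exact ⟨fun n => n.rec ⟨(0, e₀), h₀⟩ fun n x => ⟨(K n _ _ x.2, F n _ _ x.2), hF n _ _ x.2⟩,
      fun n => hK n .., fun n => heq n .., fun n => hR n _ _ _⟩
  have hmono : StrictMono fun n => (q n).1.1 := strictMono_nat_of_lt_succ hlt
  have hagree {n n'} (hn : n ≤ n') : Set.EqOn (q n').1.2 (q n).1.2 (Set.Iic (q n).1.1) := by
    induction n', hn using Nat.le_induction with
    | base => exact Set.eqOn_refl ..
    | succ n' hn ih => exact ((heq n').mono (Set.Iic_subset_Iic.2 (hmono.monotone hn))).trans ih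
  let e j := (q j).1.2 j
  have he n : Set.EqOn e (q n).1.2 (Set.Iic (q n).1.1) := fun j hj =>
    (hagree (le_max_left j n) (hmono.le_apply : j ≤ _)).symm.trans (hagree (le_max_right j n) hj)
  exact ⟨e, Set.forall_mem_range.2 fun n => hR n e (he (n + 1)),
    fun k => ⟨_, hmono.le_apply, hV (q k).2 (he k)⟩⟩

/-! ### Existence of generic branches -/

section

variable {τ : SchemeType} {𝒬 : Set (Set ℕ)} {S : Ordinal.{0} → Set (Finset Ordinal.{0})}
  {E E' : Ordinal.{0} → ℕ → Enumeration} {η ξ b : Ordinal.{0}} {k j : ℕ}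
  {e e' : ℕ → Enumeration} {P : Set ℕ} {L : ℕ → Set Enumeration} {A : Finset Ordinal.{0}}

theorem IsMaximalCapture.congr {S : Set (Finset Ordinal.{0})} {t : Finset ℕ}
    (h : IsMaximalCapture τ L S b e k t j) (hk : e' k = e k) (hk' : e' (k + 1) = e (k + 1)) :
    IsMaximalCapture τ L S b e' k t j := by
  obtain ⟨hlt, hbase, hpiece, hmem, hmax⟩ := h
  rw [← hk] at hbase hpiece hmax
  rw [← hk'] at hpiece hmem
  exact ⟨hlt, hbase, hpiece, hmem, hmax⟩

theorem IsPath.exists_isMaximalCapture (h : IsPath τ L b k e) {g : Enumeration}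
    (hg : g ∈ L (k + 1)) (he : e k = graft b g (τ.r (k + 1))) {t : Finset ℕ}
    (ht : t ⊆ Finset.range (τ.m k)) (S : Set (Finset Ordinal.{0})) :
    ∃ e', IsPath τ L b (k + 1) e' ∧ Set.EqOn e' e (Set.Iic k) ∧
      ∃ j, IsMaximalCapture τ L S b e' k t j := by
  classical
  have hr := τ.r_lt_m k
  have hn := τ.n_pos k
  let Q q := ∃ H ∈ L (k + 1), Set.EqOn H (e k) (Set.Iio (τ.r (k + 1))) ∧
    ∀ i < q, copyOf τ k H t i ∈ S
  have hQ : Q 0 := ⟨g, hg, fun s hs => by rw [he, graft_of_lt hs], by simp⟩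
  let j := Nat.findGreatest Q (τ.n (k + 1) - 1)
  have hj : j ≤ τ.n (k + 1) - 1 := Nat.findGreatest_le _
  obtain ⟨H, hH, hHe, hHS⟩ : Q j := Nat.findGreatest_spec (Nat.zero_le _) hQ
  have hjn : j < τ.n (k + 1) := by omega
  replace he : e k = graft b (H ∘ τ.shift k j) (τ.r (k + 1)) := by
    rw [he]
    refine graft_congr fun s hs => ?_
    rw [Function.comp, shift_of_lt hs, hHe hs, he, graft_of_lt hs]
  obtain ⟨e', h', heq, he'⟩ := h.exists_succ hr hH hjn (.inr le_rfl) he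
  have hk := heq Set.self_mem_Iic
  refine ⟨e', h', heq, j, hjn, ?_, ?_, fun i hi => ?_, fun q hq G hG hGe hGS => ?_⟩
  · rw [hk, he, graft_self]
  · rw [hk, he, he']
    exact isPiece_graft hr (.inr le_rfl) rfl fun _ _ => rfl
  · rw [he']
    convert hHS i hi using 1
    exact Finset.image_congr fun s hs =>
      graft_of_lt (shift_lt_of_lt (Finset.mem_range.1 (ht hs)) hi)
  · exact Nat.le_findGreatest (by omega) ⟨G, hG, hk ▸ hGe, hGS⟩

theorem isSecurable_idle (hE : ∀ η < ξ, IsGenericBranch τ 𝒬 S E η (E η)) (hξ : 0 < ξ)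
    (hP : P ∈ 𝒬) (N : ℕ) :
    IsSecurable (IsPath τ (levelBelow τ E ξ) (ω * ξ))
      fun e => ∃ u ≥ N, ∃ v ≥ u + N, IsIdle τ P e u v := by
  intro k e h
  obtain ⟨γ, -, -, u, hu, v, hv, hidle, -, e', a, ha, h', heq, he'⟩ :=
    h.exists_isIdle hE hξ (mul_pos omega0_pos hξ) hP (max N (k + 1))
  refine ⟨v, by omega, e', h', heq, fun e'' heq' =>
    ⟨u, by omega, v, by omega, hidle.1, fun j hj hjv => ?_⟩⟩
  rw [heq' hjv.le, heq' (Set.mem_Iic.2 hjv), he' j hj hjv.le, he' (j + 1) (by omega) hjv]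
  exact isPiece_graft (ha.trans_le (m_strictMono.monotone hj)) (.inl rfl) (by simp)
    (hidle.2 j hj hjv)

theorem isSecurable_realizes_self (hE : ∀ η < ξ, IsGenericBranch τ 𝒬 S E η (E η)) (hξ : 0 < ξ)
    (hA : (A : Set Ordinal.{0}) ⊆ Set.Iio (ω * ξ + ω)) (hP : P ∈ 𝒬) (N : ℕ) :
    IsSecurable (IsPath τ (levelBelow τ E ξ) (ω * ξ)) fun e =>
      Realizes τ (IsMaximalCapture τ (levelBelow τ E ξ) (S ξ) (ω * ξ) e) P e A N := by
  intro k e h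
  obtain ⟨k₁, hk₁, e₁, h₁, heq₁, hA₁⟩ := h.exists_subset hE hξ ⟨P, hP⟩ hA
  obtain ⟨γ, hγ, -, u, hu, v, -, hidle, -, e₂, a, ha, h₂, heq₂, he₂⟩ :=
    h₁.exists_isIdle hE hξ (mul_pos omega0_pos hξ) hP N
  obtain ⟨l, hlP, hul, hlv, rfl⟩ := hidle.1 a ha.le
  obtain ⟨l, rfl⟩ := Nat.exists_eq_succ_of_ne_zero (Nat.ne_zero_of_lt hul)
  replace hul : u ≤ l := Nat.lt_succ_iff.1 hul
  replace h₂ := h₂.of_eqOn (Nat.le_of_lt hlv) (Set.eqOn_refl ..)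
  have hA₂ : A ⊆ enumSet (τ.m l) (e₂ l) := by
    rw [← heq₂ Set.self_mem_Iic] at hA₁
    exact hA₁.trans (h₂.enumSet_subset (by omega))
  obtain ⟨t, ht, rfl⟩ := exists_image_eq hA₂
  have he₂l : e₂ l = graft (ω * ξ) (E γ (l + 1)) (τ.r (l + 1)) := by
    rw [he₂ l hul (Nat.le_of_lt hlv)]
    exact graft_congr fun s hs =>
      isPiece_zero_iff.1 (hidle.2 l hul hlv) (lt_trans hs (τ.r_lt_m l))
  obtain ⟨e₃, h₃, heq₃, j, hj⟩ :=
    h₂.exists_isMaximalCapture (mem_levelBelow hγ (l + 1)) he₂l ht (S ξ)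
  refine ⟨l + 1, by omega, e₃, h₃, fun i (hi : i ≤ k) => ?_, fun e' he' => ?_⟩
  · rw [heq₃ (show i ≤ l by omega), heq₂ (show i ≤ k₁ by omega), heq₁ hi]
  · have hl := he' (Nat.le_succ l)
    have hl' := he' (le_refl (l + 1))
    replace hj := hj.congr hl hl'
    exact ⟨l, by omega, hlP, t, ht, by rw [hl, heq₃ Set.self_mem_Iic], j, hj, hj.piece⟩

theorem image_eq_image_of_common_isPiece {l : ℕ} (hkl : k ≤ l)
    (h : ∀ j, k ≤ j → j < l → ∃ i < τ.n (j + 1),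
      IsPiece τ j i (e j) (e (j + 1)) ∧ IsPiece τ j i (e' j) (e' (j + 1)))
    (hinj : Set.InjOn (e l) (Set.Iio (τ.m l))) {t₀ t : Finset ℕ}
    (ht₀ : t₀ ⊆ Finset.range (τ.m k)) (ht : t ⊆ Finset.range (τ.m l))
    (heq : t.image (e l) = t₀.image (e k)) : t.image (e' l) = t₀.image (e' k) := by
  obtain ⟨σ, hσ, hσe, hσe'⟩ := exists_common_positionMap hkl h
  have himage {e : ℕ → Enumeration} (he : Set.EqOn (e k) (e l ∘ σ) (Set.Iio (τ.m k))) :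
      t₀.image (e k) = (t₀.image σ).image (e l) := by
    rw [Finset.image_image]
    exact Finset.image_congr fun s hs => he (Finset.mem_range.1 (ht₀ hs))
  have hσt₀ : t₀.image σ ⊆ Finset.range (τ.m l) := Finset.image_subset_iff.2 fun s hs =>
    Finset.mem_range.2 (hσ.mapsTo (Finset.mem_range.1 (ht₀ hs)))
  rw [← Finset.coe_range] at hinj
  rw [himage hσe, Finset.image_eq_image_iff_of_injOn hinj ht hσt₀] at heq
  rw [himage hσe', heq]

theorem isSecurable_realizes_earlier (hE : ∀ η < ξ, IsGenericBranch τ 𝒬 S E η (E η))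
    (hη : 0 < η) (hηξ : η < ξ) (hA : (A : Set Ordinal.{0}) ⊆ Set.Iio (ω * ξ + ω)) (hP : P ∈ 𝒬)
    (N : ℕ) :
    IsSecurable (IsPath τ (levelBelow τ E ξ) (ω * ξ)) fun e =>
      Realizes τ (IsMaximalCapture τ (levelBelow τ E η) (S η) (ω * η) (E η)) P e A N := by
  intro k e h
  have hξ := hη.trans hηξ
  have hE' η' (hη' : η' < ξ) := (hE η' hη').toIsBranch
  obtain ⟨k₁, hk₁, e₁, h₁, heq₁, hA₁⟩ := h.exists_subset hE hξ ⟨P, hP⟩ hA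
  obtain ⟨γ, hγ, hηγ, u, hu, e₂, h₂, heq₂, -, a, ha, he₂, c, hc, hcγ⟩ :=
    h₁.exists_attach hE hηξ (mul_pos omega0_pos hξ) hP
  rw [← heq₂ Set.self_mem_Iic] at hA₁
  obtain ⟨t₀, ht₀, rfl⟩ := exists_image_eq (hA₁.trans (h₂.enumSet_subset hu.le))
  have hLγ := isEnumeratedScheme_levelBelow fun η' hη' => hE' η' (hη'.trans hγ)
  have hγnode l := (hE' γ hγ).isNode l
  obtain ⟨l, hl, hlP, t, ht, htE, j, hj, hpiece⟩ := (hE γ hγ).realizes hη hηγ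
    (A := t₀.image (E γ u)) (by
      rw [Finset.coe_image]
      exact ((hγnode u).mapsTo hLγ).mono_left (fun s hs => Finset.mem_range.1 (ht₀ hs))
        |>.image_subset) hP (max N u)
  obtain ⟨e₃, h₃, heq₃, he₃⟩ := h₂.exists_copy hE' hγ ha he₂ hc hcγ (by omega : u ≤ l + 1)
  have ht₀t := image_eq_image_of_common_isPiece (e' := e₃) (le_of_max_le_right hl)
    (fun i hui hil => ((hE' γ hγ).exists_isPiece i).imp fun q ⟨hq, hqE⟩ =>
      ⟨hq, hqE, he₃ i hui (hil.trans l.lt_succ_self) q hq hqE⟩)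
    ((hγnode l).strictMonoOn hLγ).injOn ht₀ ht htE
  refine ⟨l + 1, by omega, e₃, h₃, fun i (hi : i ≤ k) => ?_, fun e' he' =>
    ⟨l, by omega, hlP, t, ht, ?_, j, hj, ?_⟩⟩
  · rw [heq₃ (show i ≤ u by omega), heq₂ (show i ≤ k₁ by omega), heq₁ hi]
  · rw [he' (Nat.le_succ l), ht₀t, heq₃ Set.self_mem_Iic]
  · rw [he' (Nat.le_succ l), he' (le_refl (l + 1))]
    exact he₃ l (by omega) l.lt_succ_self j hj.lt hpiece

theorem countable_Iio_of_lt_omega_one (h : ξ < ω₁) : (Set.Iio ξ).Countable := by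
  rw [← Cardinal.le_aleph0_iff_set_countable, Cardinal.mk_Iio_ordinal, Cardinal.lift_le_aleph0]
  rwa [← Cardinal.ord_aleph, Cardinal.lt_ord, ← Cardinal.succ_aleph0, Order.lt_succ_iff] at h

theorem omega_mul_lt_omega_one (h : ξ < ω₁) : ω * ξ < ω₁ :=
  (isPrincipal_mul_omega 1) omega0_lt_omega_one h

theorem countable_finset_subset {α : Type*} {s : Set α} (hs : s.Countable) :
    Countable {A : Finset α // (A : Set α) ⊆ s} := by
  have := hs.to_subtype
  refine (Set.countable_range fun B : Finset s => B.map (Function.Embedding.subtype _)).mono ?_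
  intro A hA
  classical
  exact ⟨A.subtype (· ∈ s), Finset.subtype_map_of_mem hA⟩

theorem exists_isGenericBranch_of_pos (h𝒬 : 𝒬.Countable) (hne : 𝒬.Nonempty)
    (hE : ∀ η < ξ, IsGenericBranch τ 𝒬 S E η (E η)) (hξ : 0 < ξ) (hξω : ξ < ω₁) :
    ∃ e, IsGenericBranch τ 𝒬 S E ξ e := by
  let 𝒜 := {A : Finset Ordinal.{0} // (A : Set Ordinal.{0}) ⊆ Set.Iio (ω * ξ + ω)}
  have : Countable 𝒬 := h𝒬.to_subtype
  have : Nonempty 𝒬 := hne.to_subtype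
  have : Countable (Set.Ioo 0 ξ) :=
    ((countable_Iio_of_lt_omega_one hξω).mono Set.Ioo_subset_Iio_self).to_subtype
  have : Countable 𝒜 := countable_finset_subset <| countable_Iio_of_lt_omega_one <|
    isPrincipal_add_omega 1 (omega_mul_lt_omega_one hξω) omega0_lt_omega_one
  let Idle (x : 𝒬 × ℕ) (e : ℕ → Enumeration) :=
    ∃ u ≥ x.2, ∃ v ≥ u + x.2, IsIdle τ x.1 e u v
  let Earlier (x : Set.Ioo 0 ξ × 𝒜 × 𝒬 × ℕ) (e : ℕ → Enumeration) :=
    Realizes τ (IsMaximalCapture τ (levelBelow τ E x.1) (S x.1) (ω * x.1) (E x.1)) x.2.2.1 e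
      x.2.1 x.2.2.2
  let Self (x : 𝒜 × 𝒬 × ℕ) (e : ℕ → Enumeration) :=
    Realizes τ (IsMaximalCapture τ (levelBelow τ E ξ) (S ξ) (ω * ξ) e) x.2.1 e x.1 x.2.2
  obtain ⟨e, hR, hV⟩ := exists_generic (V := IsPath τ (levelBelow τ E ξ) (ω * ξ))
    (𝓡 := Set.range Idle ∪ (Set.range Earlier ∪ Set.range Self))
    (e₀ := fun _ => graft (ω * ξ) (fun _ => 0) 0) (fun h heq => h.of_eqOn le_rfl heq)
    ⟨fun j _ => ⟨0, τ.m_pos j, _, by simp, rfl⟩, by simp⟩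
    ((Set.countable_range _).union ((Set.countable_range _).union (Set.countable_range _)))
    (Set.range_nonempty Idle).inl (by
      rintro _ (⟨⟨P, N⟩, rfl⟩ | ⟨⟨η, A, P, N⟩, rfl⟩ | ⟨⟨A, P, N⟩, rfl⟩)
      · exact isSecurable_idle hE hξ P.2 N
      · exact isSecurable_realizes_earlier hE η.2.1 η.2.2 A.2 P.2 N
      · exact isSecurable_realizes_self hE hξ A.2 P.2 N)
  have hself x : Self x e := hR _ (.inr (.inr ⟨x, rfl⟩))
  obtain ⟨P, hP⟩ := hne
  refine ⟨e, ⟨fun k => ?_, fun x hx => ?_⟩, fun P hP N => hR _ (.inl ⟨(⟨P, hP⟩, N), rfl⟩),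
    fun η hη hηξ A hA P hP N =>
      hR _ (.inr (.inl ⟨(⟨η, hη, hηξ⟩, ⟨A, hA⟩, ⟨P, hP⟩, N), rfl⟩)),
    fun _ A hA P hP N => hself (⟨A, hA⟩, ⟨P, hP⟩, N)⟩
  · obtain ⟨k', hk', h⟩ := hV k
    exact h.of_eqOn hk' (Set.eqOn_refl ..)
  · obtain ⟨k, hk⟩ := (hself (⟨{x}, by simpa using hx⟩, ⟨P, hP⟩, 0)).subset
    exact ⟨k, by simpa using hk⟩

theorem exists_idle_bound (hP : ∀ c, {l | l ∈ P ∧ τ.r l = c}.Infinite) (u : ℕ) :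
    ∃ v₀, ∀ v ≥ v₀, ∀ c ≤ τ.m u, ∃ l ∈ P, u < l ∧ l ≤ v ∧ τ.r l = c := by
  choose l hl hul using fun c => (hP c).exists_gt u
  refine ⟨(Finset.range (τ.m u + 1)).sup l, fun v hv c hc =>
    ⟨l c, (hl c).1, hul c, le_trans (Finset.le_sup ?_) hv, (hl c).2⟩⟩
  simpa using Nat.lt_succ_of_le hc

theorem isGenericBranch_zero (hcomp : τ.Compatible 𝒬) :
    IsGenericBranch τ 𝒬 S E 0 fun _ s => s := by
  have hpiece (k : ℕ) : IsPiece τ k 0 (fun s => (s : Ordinal.{0})) fun s => s :=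
    fun s _ => by simp
  refine ⟨⟨fun k => ⟨fun j _ => ⟨0, τ.m_pos j, fun _ => 0, by simp, ?_⟩,
    fun j _ => ⟨0, τ.n_pos j, hpiece j⟩⟩, fun x hx => ?_⟩, fun P hP N => ?_,
    fun η hη hη' => absurd hη' hη.not_gt, fun h => absurd h (lt_irrefl _)⟩
  · funext s
    simp [graft]
  · obtain ⟨s, rfl⟩ := lt_omega0.1 (by simpa using hx)
    exact ⟨s + 1, mem_enumSet.2 ⟨s, m_strictMono.le_apply, rfl⟩⟩
  · obtain ⟨v, hv⟩ := exists_idle_bound (hcomp P hP) N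
    exact ⟨N, le_rfl, max v (N + N), le_max_right _ _, hv _ (le_max_left _ _),
      fun j _ _ => hpiece j⟩

theorem IsGenericBranch.congr (h : IsGenericBranch τ 𝒬 S E ξ e) (hE : ∀ η < ξ, E η = E' η) :
    IsGenericBranch τ 𝒬 S E' ξ e := by
  obtain ⟨hbranch, hidle, hearlier, hself⟩ := h
  rw [levelBelow_congr hE] at hbranch hself
  refine ⟨hbranch, hidle, fun η hη hηξ => ?_, hself⟩
  rw [← levelBelow_congr fun ζ hζ => hE ζ (hζ.trans hηξ), ← hE η hηξ]
  exact hearlier η hη hηξ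

theorem exists_forall_of_step {ι β : Type*} [LinearOrder ι] [WellFoundedLT ι] [Nonempty β]
    {Q : ι → (ι → β) → β → Prop}
    (hcongr : ∀ {ξ f g b}, Q ξ f b → (∀ η < ξ, f η = g η) → Q ξ g b)
    (hstep : ∀ ξ f, (∀ η < ξ, Q η f (f η)) → ∃ b, Q ξ f b) : ∃ f, ∀ ξ, Q ξ f (f ξ) := by
  classical
  let extend (ξ : ι) (ih : (η : ι) → η < ξ → β) (η : ι) : β :=
    if h : η < ξ then ih η h else Classical.arbitrary β
  let f : ι → β := wellFounded_lt.fix fun ξ ih => Classical.epsilon (Q ξ (extend ξ ih))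
  have hf ξ : f ξ = Classical.epsilon (Q ξ (extend ξ fun η _ => f η)) := WellFounded.fix_eq ..
  refine ⟨f, fun ξ => ?_⟩
  induction ξ using WellFoundedLT.induction with
  | _ ξ ih =>
    have hext η (hη : η < ξ) : f η = extend ξ (fun η _ => f η) η := by simp [extend, hη]
    obtain ⟨b, hb⟩ := hstep ξ f ih
    rw [hf]
    exact hcongr (Classical.epsilon_spec ⟨b, hcongr hb hext⟩) fun η hη => (hext η hη).symm

theorem exists_genericBranches (h𝒬 : 𝒬.Countable) (hne : 𝒬.Nonempty) (hcomp : τ.Compatible 𝒬)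
    (S : Ordinal.{0} → Set (Finset Ordinal.{0})) :
    ∃ E : Ordinal.{0} → ℕ → Enumeration, ∀ ξ < ω₁, IsGenericBranch τ 𝒬 S E ξ (E ξ) := by
  refine exists_forall_of_step (Q := fun ξ E e => ξ < ω₁ → IsGenericBranch τ 𝒬 S E ξ e)
    (fun h hE hξ => (h hξ).congr hE) fun ξ E hE => ?_
  by_cases hξ : ξ < ω₁
  · rcases eq_or_ne ξ 0 with rfl | hξ₀
    · exact ⟨_, fun _ => isGenericBranch_zero hcomp⟩
    · obtain ⟨e, he⟩ := exists_isGenericBranch_of_pos h𝒬 hne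
        (fun η hη => hE η hη (hη.trans hξ)) (pos_iff_ne_zero.2 hξ₀) hξ
      exact ⟨e, fun _ => he⟩
  · exact ⟨fun _ _ => 0, fun h => absurd h hξ⟩

end

/-! ### The construction scheme of an enumerated scheme -/

/-- The family of all sets enumerated by `L`. -/
def enumFamily (τ : SchemeType) (L : ℕ → Set Enumeration) : Set (Finset Ordinal.{0}) :=
  {F | ∃ k, ∃ f ∈ L k, enumSet (τ.m k) f = F}

theorem IsPositionMap.exists_factor {τ : SchemeType} {k j l : ℕ} {σ : ℕ → ℕ}
    (h : IsPositionMap τ k l σ) (hkj : k ≤ j) (hjl : j ≤ l) :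
    ∃ σ₁ σ₂, IsPositionMap τ k j σ₁ ∧ IsPositionMap τ j l σ₂ ∧ σ = σ₂ ∘ σ₁ := by
  induction h with
  | refl =>
    obtain rfl : j = k := le_antisymm hjl hkj
    exact ⟨id, id, .refl, .refl, rfl⟩
  | @step l i σ h hi ih =>
    rcases hjl.eq_or_lt with rfl | hjl
    · exact ⟨_, id, h.step hi, .refl, rfl⟩
    · obtain ⟨σ₁, σ₂, h₁, h₂, rfl⟩ := ih (Nat.lt_succ_iff.1 hjl)
      exact ⟨σ₁, _, h₁, h₂.step hi, rfl⟩

theorem IsPositionMap.exists_eq_shift {τ : SchemeType} {k : ℕ} {σ : ℕ → ℕ}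
    (h : IsPositionMap τ k (k + 1) σ) : ∃ i < τ.n (k + 1), σ = τ.shift k i := by
  cases h with
  | step h hi => exact ⟨_, hi, by rw [h.eq_id, Function.comp_id]⟩

theorem IsDecomposition.piece_subset {τ : SchemeType} {ℱ : Set (Finset Ordinal.{0})} {k i : ℕ}
    {F R : Finset Ordinal.{0}} {P : ℕ → Finset Ordinal.{0}} (h : IsDecomposition τ ℱ k F P R)
    (hi : i < τ.n (k + 1)) : P i ⊆ F := by
  rw [h.union_eq]
  exact Finset.subset_biUnion_of_mem P (Finset.mem_range.2 hi)

namespace IsEnumeratedScheme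

variable {τ : SchemeType} {X : Set Ordinal.{0}} {L : ℕ → Set Enumeration} {k l i j : ℕ}
  {f h : Enumeration} {x y : Ordinal.{0}} {A F : Finset Ordinal.{0}}

theorem enumSet_mem_FIN (hL : IsEnumeratedScheme τ X L) (hf : f ∈ L k) :
    enumSet (τ.m k) f ∈ FIN X := by
  refine ⟨⟨f 0, mem_enumSet.2 ⟨0, τ.m_pos k, rfl⟩⟩, fun x hx => ?_⟩
  obtain ⟨s, hs, rfl⟩ := mem_enumSet.1 hx
  exact hL.mapsTo f hf hs

theorem card_enumSet (hL : IsEnumeratedScheme τ X L) (hf : f ∈ L k) {m : ℕ} (hm : m ≤ τ.m k) :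
    (enumSet m f).card = m := by
  rw [enumSet, Finset.card_image_of_injOn, Finset.card_range]
  exact (hL.strictMonoOn f hf).injOn.mono fun s hs => (Finset.mem_range.1 hs).trans_le hm

theorem enumSet_piece_subset (f : Enumeration) (hi : i < τ.n (k + 1)) :
    enumSet (τ.m k) (f ∘ τ.shift k i) ⊆ enumSet (τ.m (k + 1)) f :=
  enumSet_subset_of_eqOn_comp (Set.eqOn_refl ..) fun _ hs => shift_lt hs hi

theorem enumSet_piece_ssubset (hL : IsEnumeratedScheme τ X L) (hf : f ∈ L (k + 1))
    (hi : i < τ.n (k + 1)) : enumSet (τ.m k) (f ∘ τ.shift k i) ⊂ enumSet (τ.m (k + 1)) f := by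
  refine (enumSet_piece_subset f hi).ssubset_of_ne fun h => ?_
  replace h := congrArg Finset.card h
  rw [hL.card_enumSet (hL.piece_mem f hf i hi) le_rfl, hL.card_enumSet hf le_rfl] at h
  exact (m_strictMono k.lt_succ_self).ne h

theorem exists_superset (hL : IsEnumeratedScheme τ X L) (hf : f ∈ L k) (hkl : k ≤ l) :
    ∃ g ∈ L l, enumSet (τ.m k) f ⊆ enumSet (τ.m l) g := by
  obtain ⟨l', hl', g, hg, hfg⟩ := hL.cofinal _ (hL.enumSet_mem_FIN hf) l
  obtain ⟨σ, hσ, heq⟩ := hL.exists_positionMap hf hg (hkl.trans hl') hfg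
  obtain ⟨σ₁, σ₂, h₁, h₂, rfl⟩ := hσ.exists_factor hkl hl'
  exact ⟨_, hL.comp_mem hg h₂, enumSet_subset_of_eqOn_comp heq h₁.mapsTo⟩

theorem rank_eq (hL : IsEnumeratedScheme τ X L) (hf : f ∈ L k)
    (hF : enumSet (τ.m k) f ∈ enumFamily τ L) :
    IsWellFounded.rank (α := enumFamily τ L) (· < ·) ⟨enumSet (τ.m k) f, hF⟩ = (k : Ordinal) := by
  induction k using Nat.strong_induction_on generalizing f with
  | _ k ih =>
    apply le_antisymm
    · rw [IsWellFounded.rank_eq]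
      refine Ordinal.iSup_le ?_
      rintro ⟨⟨F, hF'⟩, hlt⟩
      obtain ⟨j, g, hg, rfl⟩ := id hF'
      have hcard := Finset.card_lt_card (show enumSet (τ.m j) g ⊂ enumSet (τ.m k) f from hlt)
      rw [hL.card_enumSet hg le_rfl, hL.card_enumSet hf le_rfl, m_strictMono.lt_iff_lt] at hcard
      rw [ih j hcard hg, Order.succ_le_iff]
      exact Nat.cast_lt.2 hcard
    · cases k with
      | zero => simp
      | succ j =>
        have hg := hL.piece_mem f hf 0 (τ.n_pos j)
        have hmem : enumSet (τ.m j) (f ∘ τ.shift j 0) ∈ enumFamily τ L := ⟨j, _, hg, rfl⟩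
        have hlt : (⟨_, hmem⟩ : enumFamily τ L) < ⟨_, hF⟩ :=
          hL.enumSet_piece_ssubset hf (τ.n_pos j)
        replace hlt := IsWellFounded.rank_lt_of_rel
          (r := ((· < ·) : enumFamily τ L → enumFamily τ L → Prop)) hlt
        rwa [ih j j.lt_succ_self hg, ← Order.succ_le_iff, Order.succ_eq_add_one,
          ← Nat.cast_succ] at hlt

theorem mem_level_iff (hL : IsEnumeratedScheme τ X L) :
    F ∈ level (enumFamily τ L) k ↔ ∃ f ∈ L k, enumSet (τ.m k) f = F := by
  constructor
  · rintro ⟨hF, hr⟩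
    obtain ⟨j, f, hf, rfl⟩ := id hF
    rw [hL.rank_eq hf, Nat.cast_inj] at hr
    subst hr
    exact ⟨f, hf, rfl⟩
  · rintro ⟨f, hf, rfl⟩
    exact ⟨⟨k, f, hf, rfl⟩, hL.rank_eq hf _⟩

theorem mem_piece_sdiff_root_iff (hL : IsEnumeratedScheme τ X L) (hh : h ∈ L (k + 1))
    (hi : i < τ.n (k + 1)) :
    x ∈ enumSet (τ.m k) (h ∘ τ.shift k i) \ enumSet (τ.r (k + 1)) h ↔
      ∃ s, τ.r (k + 1) ≤ s ∧ s < τ.m k ∧ h (τ.shift k i s) = x := by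
  rw [Finset.mem_sdiff, mem_enumSet, mem_enumSet]
  constructor
  · rintro ⟨⟨s, hs, rfl⟩, hx⟩
    exact ⟨s, le_of_not_gt fun hlt => hx ⟨s, hlt, by rw [Function.comp, shift_of_lt hlt]⟩, hs, rfl⟩
  · rintro ⟨s, hrs, hs, rfl⟩
    refine ⟨⟨s, hs, rfl⟩, ?_⟩
    rintro ⟨s', hs', e⟩
    have hs'm : s' < τ.m (k + 1) :=
      (hs'.trans (τ.r_lt_m k)).trans (m_strictMono k.lt_succ_self)
    have := (hL.strictMonoOn h hh).injOn hs'm (shift_lt hs hi) e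
    have := le_shift (τ := τ) (k := k) (i := i) (s := s)
    omega

theorem piece_inter_piece (hL : IsEnumeratedScheme τ X L) (hh : h ∈ L (k + 1))
    (hi : i < τ.n (k + 1)) (hj : j < τ.n (k + 1)) (hij : i ≠ j) :
    enumSet (τ.m k) (h ∘ τ.shift k i) ∩ enumSet (τ.m k) (h ∘ τ.shift k j) =
      enumSet (τ.r (k + 1)) h := by
  ext x
  simp only [Finset.mem_inter, mem_enumSet]
  constructor
  · rintro ⟨⟨s, hs, rfl⟩, s', hs', e⟩
    obtain ⟨rfl, hji | hr⟩ := shift_eq_shift hs' hs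
      ((hL.strictMonoOn h hh).injOn (shift_lt hs' hj) (shift_lt hs hi) e)
    · exact absurd hji hij.symm
    · exact ⟨s', hr, by rw [Function.comp, shift_of_lt hr]⟩
  · rintro ⟨s, hs, rfl⟩
    have hsm := lt_trans hs (τ.r_lt_m k)
    exact ⟨⟨s, hsm, by rw [Function.comp, shift_of_lt hs]⟩,
      s, hsm, by rw [Function.comp, shift_of_lt hs]⟩

theorem isDecomposition (hL : IsEnumeratedScheme τ X L) (hh : h ∈ L (k + 1)) :
    IsDecomposition τ (enumFamily τ L) k (enumSet (τ.m (k + 1)) h)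
      (fun i => enumSet (τ.m k) (h ∘ τ.shift k i)) (enumSet (τ.r (k + 1)) h) := by
  have hr := τ.r_lt_m k
  have hrm : τ.r (k + 1) < τ.m (k + 1) := hr.trans (m_strictMono k.lt_succ_self)
  have hmono := hL.strictMonoOn h hh
  have hne i (hi : i < τ.n (k + 1)) :
      (enumSet (τ.m k) (h ∘ τ.shift k i) \ enumSet (τ.r (k + 1)) h).Nonempty :=
    ⟨_, (hL.mem_piece_sdiff_root_iff hh hi).2 ⟨_, le_rfl, hr, rfl⟩⟩
  refine ⟨fun i hi => hL.mem_level_iff.2 ⟨_, hL.piece_mem h hh i hi, rfl⟩, ?_,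
    fun i hi j hj hij => hL.piece_inter_piece hh hi hj hij, hL.card_enumSet hh hrm.le,
    fun i hi => ⟨hne i hi, fun x hx y hy => ?_⟩,
    fun i j hij hj => ⟨hne j hj, fun x hx y hy => ?_⟩⟩
  · refine Finset.Subset.antisymm (fun x hx => ?_) (Finset.biUnion_subset.2 fun i hi =>
      enumSet_piece_subset h (Finset.mem_range.1 hi))
    obtain ⟨s, hs, rfl⟩ := mem_enumSet.1 hx
    obtain ⟨i, hi, q, hq, rfl⟩ := exists_shift_eq hs
    exact Finset.mem_biUnion.2 ⟨i, Finset.mem_range.2 hi, mem_enumSet.2 ⟨q, hq, rfl⟩⟩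
  · obtain ⟨s, hs, rfl⟩ := mem_enumSet.1 hx
    obtain ⟨s', hs', hsm, rfl⟩ := (hL.mem_piece_sdiff_root_iff hh hi).1 hy
    exact hmono (hs.trans hrm) (shift_lt hsm hi) ((hs.trans_le hs').trans_le le_shift)
  · obtain ⟨s, -, hsm, rfl⟩ := (hL.mem_piece_sdiff_root_iff hh (hij.trans hj)).1 hx
    obtain ⟨s', hs', hsm', rfl⟩ := (hL.mem_piece_sdiff_root_iff hh hj).1 hy
    exact hmono (shift_lt hsm (hij.trans hj)) (shift_lt hsm' hj) (shift_lt_shift hsm hs' hij)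

theorem initSeg_inter (hL : IsEnumeratedScheme τ X L) (hf : f ∈ L k) (hh : h ∈ L k) :
    InitSeg (enumSet (τ.m k) f ∩ enumSet (τ.m k) h) (enumSet (τ.m k) f) := by
  refine ⟨Finset.inter_subset_left, fun x hx y hy hyx => ?_⟩
  rw [Finset.mem_inter, mem_enumSet, mem_enumSet] at hx
  obtain ⟨⟨a, ha, rfl⟩, b, hb, e⟩ := hx
  obtain ⟨c, hc, rfl⟩ := mem_enumSet.1 hy
  obtain ⟨rfl, heq⟩ := hL.coherent f hf h hh a ha b hb e.symm
  have hca := ((hL.strictMonoOn f hf).lt_iff_lt hc ha).1 hyx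
  exact Finset.mem_inter.2 ⟨hy, mem_enumSet.2 ⟨c, hc, (heq hca.le).symm⟩⟩

theorem isConstructionScheme (hL : IsEnumeratedScheme τ X L) :
    IsConstructionScheme τ X (enumFamily τ L) where
  subset_FIN := by
    rintro _ ⟨k, f, hf, rfl⟩
    exact hL.enumSet_mem_FIN hf
  cofinal A hA := by
    obtain ⟨k, -, f, hf, hAf⟩ := hL.cofinal A hA 0
    exact ⟨_, ⟨k, f, hf, rfl⟩, hAf⟩
  card_eq k F hF := by
    obtain ⟨f, hf, rfl⟩ := hL.mem_level_iff.1 hF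
    exact hL.card_enumSet hf le_rfl
  initSeg k E hE F hF := by
    obtain ⟨f, hf, rfl⟩ := hL.mem_level_iff.1 hE
    obtain ⟨g, hg, rfl⟩ := hL.mem_level_iff.1 hF
    exact ⟨hL.initSeg_inter hf hg, by rw [Finset.inter_comm]; exact hL.initSeg_inter hg hf⟩
  decomposition k F hF := by
    obtain ⟨f, hf, rfl⟩ := hL.mem_level_iff.1 hF
    exact ⟨_, _, hL.isDecomposition hf⟩

theorem decomposition_unique (hL : IsEnumeratedScheme τ X L) (hh : h ∈ L (k + 1))
    {P : ℕ → Finset Ordinal.{0}} {R : Finset Ordinal.{0}}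
    (hd : IsDecomposition τ (enumFamily τ L) k (enumSet (τ.m (k + 1)) h) P R) :
    (∀ j < τ.n (k + 1), P j = enumSet (τ.m k) (h ∘ τ.shift k j)) ∧
      R = enumSet (τ.r (k + 1)) h := by
  have hn := τ.two_le_n k
  have hd₀ := hL.isDecomposition hh
  have hpiece (j : Fin (τ.n (k + 1))) :
      ∃ i : Fin (τ.n (k + 1)), P j = enumSet (τ.m k) (h ∘ τ.shift k i) := by
    obtain ⟨f, hf, hfP⟩ := hL.mem_level_iff.1 (hd.mem_level j j.2)
    obtain ⟨σ, hσ, heq⟩ := hL.exists_positionMap hf hh k.le_succ (hfP ▸ hd.piece_subset j.2)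
    obtain ⟨i, hi, rfl⟩ := hσ.exists_eq_shift
    exact ⟨⟨i, hi⟩, by rw [← hfP, enumSet_congr heq]⟩
  choose π hπ using hpiece
  have hinj {i j} (hij : i < j) : π i ≠ π j := fun e => by
    have hPR := hd.inter_eq i i.2 j j.2 (Fin.val_ne_of_ne hij.ne)
    rw [hπ i, hπ j, e, Finset.inter_self, ← hπ j] at hPR
    simpa [hPR] using (hd.tails_below i j hij j.2).1
  have hR : R = enumSet (τ.r (k + 1)) h := by
    have h01 : (⟨0, by omega⟩ : Fin (τ.n (k + 1))) < ⟨1, hn⟩ := by simp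
    rw [← hd.inter_eq 0 (by omega) 1 hn (by omega), hπ ⟨0, by omega⟩, hπ ⟨1, hn⟩]
    exact hd₀.inter_eq _ (π _).2 _ (π _).2 (Fin.val_ne_of_ne (hinj h01))
  have hmono : StrictMono π := fun i j hij => by
    refine (lt_or_gt_of_ne (hinj hij)).resolve_right fun hlt => ?_
    have hPij := hd.tails_below i j hij j.2
    rw [hπ i, hπ j, hR] at hPij
    obtain ⟨hne, hbelow⟩ := hd₀.tails_below _ _ hlt (π i).2
    obtain ⟨x, hx⟩ := hne
    obtain ⟨y, hy⟩ := hPij.1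
    exact lt_asymm (hPij.2 x hx y hy) (hbelow y hy x hx)
  have hid : π = id := hmono.eq_id
  exact ⟨fun j hj => by simpa [hid] using hπ ⟨j, hj⟩, hR⟩

/-! ### Captured families -/

theorem rho_le (hL : IsEnumeratedScheme τ X L) (hf : f ∈ L k) (hx : x ∈ enumSet (τ.m k) f)
    (hy : y ∈ enumSet (τ.m k) f) : rho (enumFamily τ L) x y ≤ k :=
  Nat.sInf_le ⟨_, hL.mem_level_iff.2 ⟨f, hf, rfl⟩, hx, hy⟩

theorem diam_le (hL : IsEnumeratedScheme τ X L) (hf : f ∈ L k) (hA : A ⊆ enumSet (τ.m k) f) :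
    diam (enumFamily τ L) A ≤ k := by
  refine Finset.sup_le fun p hp => ?_
  rw [Finset.mem_product] at hp
  exact hL.rho_le hf (hA hp.1) (hA hp.2)

theorem exists_of_rho_le (hL : IsEnumeratedScheme τ X L) (hx : x ∈ X) (hy : y ∈ X)
    (h : rho (enumFamily τ L) x y ≤ k) :
    ∃ f ∈ L k, x ∈ enumSet (τ.m k) f ∧ y ∈ enumSet (τ.m k) f := by
  obtain ⟨l, -, f, hf, hxy⟩ := hL.cofinal {x, y}
    ⟨by simp, by simp [Set.insert_subset_iff, hx, hy]⟩ 0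
  obtain ⟨F, hF, hxF, hyF⟩ := Nat.sInf_mem
    (s := {k | ∃ F ∈ level (enumFamily τ L) k, x ∈ F ∧ y ∈ F})
    ⟨l, _, hL.mem_level_iff.2 ⟨f, hf, rfl⟩, hxy (by simp), hxy (by simp)⟩
  obtain ⟨f, hf, rfl⟩ := hL.mem_level_iff.1 hF
  obtain ⟨g, hg, hfg⟩ := hL.exists_superset hf h
  exact ⟨g, hg, hfg hxF, hfg hyF⟩

theorem lt_rho (hL : IsEnumeratedScheme τ X L) (hh : h ∈ L (k + 1)) (hi : i < τ.n (k + 1))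
    (hj : j < τ.n (k + 1)) (hij : i ≠ j) {s : ℕ} (hrs : τ.r (k + 1) ≤ s) (hs : s < τ.m k) :
    k < rho (enumFamily τ L) (h (τ.shift k i s)) (h (τ.shift k j s)) := by
  by_contra! hle
  obtain ⟨f, hf, hxf, hyf⟩ := hL.exists_of_rho_le (hL.mapsTo h hh (shift_lt hs hi))
    (hL.mapsTo h hh (shift_lt hs hj)) hle
  obtain ⟨a, ha, e⟩ := mem_enumSet.1 hxf
  obtain ⟨b, hb, e'⟩ := mem_enumSet.1 hyf
  obtain ⟨rfl, -⟩ := hL.coherent f hf _ (hL.piece_mem h hh i hi) a ha s hs e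
  obtain ⟨rfl, -⟩ := hL.coherent f hf _ (hL.piece_mem h hh j hj) b hb a hs e'
  have hshift := (hL.strictMonoOn h hh).injOn (shift_lt hs hi) (shift_lt hs hj) (e.symm.trans e')
  exact (shift_eq_shift hs hs hshift).2.elim hij hrs.not_gt

end IsEnumeratedScheme

theorem exists_orderIso_image {α β : Type*} [LinearOrder α] [LinearOrder β] {A t : Set α}
    {f g : α → β} (hf : StrictMonoOn f A) (hg : StrictMonoOn g A) (ht : t ⊆ A) :
    ∃ H : (f '' A) ≃o (g '' A), (fun x => (H x : β)) '' {x | (x : β) ∈ f '' t} = g '' t := by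
  let H := (hf.orderIso f A).symm.trans (hg.orderIso g A)
  have hH s (hs : s ∈ A) : (H ⟨f s, Set.mem_image_of_mem f hs⟩ : β) = g s :=
    congrArg (fun a => (hg.orderIso g A a : β)) ((hf.orderIso f A).symm_apply_apply ⟨s, hs⟩)
  refine ⟨H, Set.ext fun y => ⟨?_, ?_⟩⟩
  · rintro ⟨⟨x, hx⟩, ⟨s, hs, rfl⟩, rfl⟩
    exact ⟨s, hs, (hH s (ht hs)).symm⟩
  · rintro ⟨s, hs, rfl⟩
    exact ⟨⟨f s, Set.mem_image_of_mem f (ht hs)⟩, Set.mem_image_of_mem f hs, hH s (ht hs)⟩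

theorem copyOf_subset_piece {τ : SchemeType} {k : ℕ} {t : Finset ℕ}
    (ht : t ⊆ Finset.range (τ.m k)) (h : Enumeration) (i : ℕ) :
    copyOf τ k h t i ⊆ enumSet (τ.m k) (h ∘ τ.shift k i) :=
  Finset.image_subset_image ht

theorem copyOf_subset {τ : SchemeType} {k i : ℕ} {t : Finset ℕ}
    (ht : t ⊆ Finset.range (τ.m k)) (h : Enumeration) (hi : i < τ.n (k + 1)) :
    copyOf τ k h t i ⊆ enumSet (τ.m (k + 1)) h :=
  (copyOf_subset_piece ht h i).trans (IsEnumeratedScheme.enumSet_piece_subset h hi)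

namespace IsEnumeratedScheme

variable {τ : SchemeType} {X : Set Ordinal.{0}} {L : ℕ → Set Enumeration} {k i j : ℕ}
  {h : Enumeration} {t : Finset ℕ} {A : Finset Ordinal.{0}}

theorem xiEq_copyOf_iff (hL : IsEnumeratedScheme τ X L) (hh : h ∈ L (k + 1))
    (ht : t ⊆ Finset.range (τ.m k)) (htr : ∃ s ∈ t, τ.r (k + 1) ≤ s) (hi : i < τ.n (k + 1))
    {z : ℤ} : XiEq τ (enumFamily τ L) (copyOf τ k h t i) (k + 1) z ↔ z = i := by
  obtain ⟨s, hst, hrs⟩ := htr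
  have hsm := Finset.mem_range.1 (ht hst)
  have hx : h (τ.shift k i s) ∈ copyOf τ k h t i := Finset.mem_image_of_mem _ hst
  have hrm := (τ.r_lt_m k).trans (τ.m_strictMono k.lt_succ_self)
  have hpos {g} (hg : g ∈ L (k + 1)) {p} (hp : p < τ.m (k + 1)) (e : g p = h (τ.shift k i s)) :
      p = τ.shift k i s := (hL.coherent g hg h hh p hp _ (shift_lt hsm hi) e).1
  have hroot {g} (hg : g ∈ L (k + 1)) : ¬ copyOf τ k h t i ⊆ enumSet (τ.r (k + 1)) g := fun hR => by
    obtain ⟨p, hp, e⟩ := mem_enumSet.1 (hR hx)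
    exact (hrs.trans le_shift).not_gt (hpos hg (hp.trans hrm) e ▸ hp)
  constructor
  · rintro ⟨k', hk, F, hF, -, P, R, hd, hcase⟩
    obtain rfl : k = k' := by omega
    obtain ⟨g, hg, rfl⟩ := hL.mem_level_iff.1 hF
    obtain ⟨hP, rfl⟩ := hL.decomposition_unique hg hd
    rcases hcase with ⟨hR, -⟩ | ⟨-, j, hj, hPj, rfl⟩
    · exact absurd hR (hroot hg)
    · rw [hP j hj] at hPj
      obtain ⟨q, hq, e⟩ := mem_enumSet.1 (hPj hx)
      have hqs := shift_eq_shift hq hsm (hpos hg (shift_lt hq hj) e)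
      exact congrArg _ (hqs.2.resolve_right (hqs.1 ▸ hrs.not_gt))
  · rintro rfl
    exact ⟨k, rfl, _, hL.mem_level_iff.2 ⟨h, hh, rfl⟩, copyOf_subset ht h hi, _, _,
      hL.isDecomposition hh, .inr ⟨hroot hh, i, hi, copyOf_subset_piece ht h i, rfl⟩⟩

theorem closure_copyOf (hL : IsEnumeratedScheme τ X L) (hh : h ∈ L (k + 1))
    (ht : t ⊆ Finset.range (τ.m k)) (hi : i < τ.n (k + 1)) {M : ℕ} (hM : IsGreatest (t : Set ℕ) M) :
    closure X (enumFamily τ L) (copyOf τ k h t i) k = (h ∘ τ.shift k i) '' Set.Iic M := by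
  have hp := hL.piece_mem h hh i hi
  have hMm := Finset.mem_range.1 (ht hM.1)
  ext x
  constructor
  · rintro ⟨hxX, y, hy, hxy, hrho⟩
    obtain ⟨s, hs, rfl⟩ := Finset.mem_image.1 hy
    have hsm := Finset.mem_range.1 (ht hs)
    obtain ⟨f, hf, hxf, hyf⟩ := hL.exists_of_rho_le hxX (hL.mapsTo _ hp hsm) hrho
    obtain ⟨a, ha, rfl⟩ := mem_enumSet.1 hxf
    obtain ⟨b, hb, e⟩ := mem_enumSet.1 hyf
    obtain ⟨rfl, heq⟩ := hL.coherent f hf _ hp b hb s hsm e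
    replace e : f b = h (τ.shift k i b) := e
    rw [← e, (hL.strictMonoOn f hf).le_iff_le ha hb] at hxy
    exact ⟨a, hxy.trans (hM.2 hs), (heq hxy).symm⟩
  · rintro ⟨s, hs, rfl⟩
    have hsm : s < τ.m k := lt_of_le_of_lt hs hMm
    exact ⟨hL.mapsTo _ hp hsm, _, Finset.mem_image_of_mem _ hM.1,
      (hL.strictMonoOn _ hp).monotoneOn hsm hMm hs,
      hL.rho_le hp (mem_enumSet.2 ⟨s, hsm, rfl⟩) (mem_enumSet.2 ⟨M, hMm, rfl⟩)⟩

theorem diam_copyOf_lt (hL : IsEnumeratedScheme τ X L) (hh : h ∈ L (k + 1))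
    (ht : t ⊆ Finset.range (τ.m k)) (hi : i < τ.n (k + 1)) :
    diam (enumFamily τ L) (copyOf τ k h t i) < k + 1 :=
  Nat.lt_succ_of_le (hL.diam_le (hL.piece_mem h hh i hi) (copyOf_subset_piece ht h i))

theorem diam_eq_of_copyOf_subset (hL : IsEnumeratedScheme τ X L) (hh : h ∈ L (k + 1))
    (ht : t ⊆ Finset.range (τ.m k)) (htr : ∃ s ∈ t, τ.r (k + 1) ≤ s) (hi : i < τ.n (k + 1))
    (hj : j < τ.n (k + 1)) (hij : i ≠ j) (hA : A ⊆ enumSet (τ.m (k + 1)) h)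
    (hiA : copyOf τ k h t i ⊆ A) (hjA : copyOf τ k h t j ⊆ A) :
    diam (enumFamily τ L) A = k + 1 := by
  obtain ⟨s, hst, hrs⟩ := htr
  refine le_antisymm (hL.diam_le hh hA) ?_
  calc k + 1 ≤ rho (enumFamily τ L) (h (τ.shift k i s)) (h (τ.shift k j s)) :=
        hL.lt_rho hh hi hj hij hrs (Finset.mem_range.1 (ht hst))
    _ ≤ diam (enumFamily τ L) A :=
        Finset.le_sup (f := fun p : Ordinal.{0} × Ordinal.{0} => rho (enumFamily τ L) p.1 p.2)
          (Finset.mk_mem_product (hiA (Finset.mem_image_of_mem _ hst))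
            (hjA (Finset.mem_image_of_mem _ hst)))

theorem stronglyIsomorphic_copyOf (hL : IsEnumeratedScheme τ X L) (hh : h ∈ L (k + 1))
    (ht : t ⊆ Finset.range (τ.m k)) (htr : ∃ s ∈ t, τ.r (k + 1) ≤ s) (hi : i < τ.n (k + 1))
    (hj : j < τ.n (k + 1)) (hij : i ≠ j) :
    StronglyIsomorphic X (enumFamily τ L) (copyOf τ k h t i) (copyOf τ k h t j) := by
  have hd := hL.diam_eq_of_copyOf_subset hh ht htr hi hj hij
    (Finset.union_subset (copyOf_subset ht h hi) (copyOf_subset ht h hj))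
    Finset.subset_union_left Finset.subset_union_right
  have hM : IsGreatest (t : Set ℕ) (t.max' (htr.imp fun _ => And.left)) := t.isGreatest_max' _
  have hmono {i} (hi : i < τ.n (k + 1)) : StrictMonoOn (h ∘ τ.shift k i) (Set.Iic (t.max' _)) :=
    (hL.strictMonoOn _ (hL.piece_mem h hh i hi)).mono
      fun s hs => lt_of_le_of_lt hs (Finset.mem_range.1 (ht hM.1))
  unfold StronglyIsomorphic
  rw [hd, Nat.add_sub_cancel, hL.closure_copyOf hh ht hi hM, hL.closure_copyOf hh ht hj hM]
  obtain ⟨H, hH⟩ := exists_orderIso_image (hmono hi) (hmono hj) fun _ hs => hM.2 hs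
  refine ⟨hL.diam_copyOf_lt hh ht hi, hL.diam_copyOf_lt hh ht hj, H, ?_⟩
  rw [copyOf, copyOf, Finset.coe_image]
  simp only [← Finset.mem_coe, Finset.coe_image]
  exact hH

theorem injOn_copyOf (hL : IsEnumeratedScheme τ X L) (hh : h ∈ L (k + 1))
    (ht : t ⊆ Finset.range (τ.m k)) (htr : ∃ s ∈ t, τ.r (k + 1) ≤ s) :
    Set.InjOn (copyOf τ k h t) (Finset.range (τ.n (k + 1))) := by
  intro i hi j hj e
  have hXi := (hL.xiEq_copyOf_iff hh ht htr (Finset.mem_range.1 hi)).2 rfl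
  rw [e, hL.xiEq_copyOf_iff hh ht htr (Finset.mem_range.1 hj)] at hXi
  exact Int.ofNat_inj.1 hXi

theorem isFullyCaptured_copyOf (hL : IsEnumeratedScheme τ X L) (hh : h ∈ L (k + 1))
    (ht : t ⊆ Finset.range (τ.m k)) (htr : ∃ s ∈ t, τ.r (k + 1) ≤ s) :
    IsFullyCaptured τ X (enumFamily τ L) ((Finset.range (τ.n (k + 1))).image (copyOf τ k h t))
      (k + 1) := by
  have hn := τ.two_le_n k
  have hcard : ((Finset.range (τ.n (k + 1))).image (copyOf τ k h t)).card = τ.n (k + 1) := by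
    rw [Finset.card_image_of_injOn (hL.injOn_copyOf hh ht htr), Finset.card_range]
  have hmem {i} (hi : i < τ.n (k + 1)) :=
    Finset.mem_image_of_mem (copyOf τ k h t) (Finset.mem_range.2 hi)
  refine ⟨⟨by rwa [hcard], hcard.le, ?_, ?_, ?_, ?_⟩, hcard⟩
  · have hn₀ := zero_lt_two.trans_le hn
    refine hL.diam_eq_of_copyOf_subset hh ht htr hn₀ hn zero_ne_one
      (Finset.biUnion_subset.2 ?_) (Finset.subset_biUnion_of_mem id (hmem hn₀))
      (Finset.subset_biUnion_of_mem id (hmem hn))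
    simp only [Finset.forall_mem_image, Finset.mem_range]
    exact fun i hi => copyOf_subset ht h hi
  · simp only [Finset.forall_mem_image, Finset.mem_range]
    exact fun i hi => hL.diam_copyOf_lt hh ht hi
  · rw [hcard]
    ext z
    simp only [Set.mem_ofPred_eq, Finset.exists_mem_image, Finset.mem_range]
    constructor
    · rintro ⟨i, hi, hz⟩
      rw [hL.xiEq_copyOf_iff hh ht htr hi] at hz
      omega
    · rintro ⟨h₀, h₁⟩
      lift z to ℕ using h₀
      exact ⟨z, Int.ofNat_lt.1 h₁, (hL.xiEq_copyOf_iff hh ht htr (Int.ofNat_lt.1 h₁)).2 rfl⟩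
  · simp only [Finset.forall_mem_image, Finset.mem_range]
    exact fun i hi j hj hne =>
      hL.stronglyIsomorphic_copyOf hh ht htr hi hj fun e => hne (congrArg _ e)

end IsEnumeratedScheme

/-! ### Guessing families of finite sets -/

/-- The form in which `◇` is used: every family `𝒮` of finite subsets of `ω₁` is guessed by
`S ξ` below `ω * ξ`, for some `ξ` such that `G` maps the finite subsets of `ω * ξ` below `ξ`. -/
def IsGuessing (S : Ordinal.{0} → Set (Finset Ordinal.{0})) : Prop :=
  ∀ 𝒮 ⊆ FIN (Set.Iio ω₁), ∀ G : Finset Ordinal.{0} → Ordinal.{0}, (∀ A, G A < ω₁) →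
    ∃ ξ < ω₁, 0 < ξ ∧
      (∀ A : Finset Ordinal.{0}, (A : Set Ordinal.{0}) ⊆ Set.Iio (ω * ξ) → G A < ξ) ∧
      S ξ = {A ∈ 𝒮 | (A : Set Ordinal.{0}) ⊆ Set.Iio (ω * ξ)}

theorem exists_subset_Iio {α ι : Type*} [LinearOrder α] [Nonempty ι] {f : ι → α} {a : α}
    (h : ∀ x < a, ∃ i, x < f i) {A : Finset α} (hA : (A : Set α) ⊆ Set.Iio a) :
    ∃ i, (A : Set α) ⊆ Set.Iio (f i) := by
  rcases A.eq_empty_or_nonempty with rfl | hne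
  · exact ⟨Classical.arbitrary ι, by simp⟩
  · obtain ⟨i, hi⟩ := h _ (hA (A.max'_mem hne))
    exact ⟨i, fun x hx => (A.le_max' x hx).trans_lt hi⟩

section

variable {G : Finset Ordinal.{0} → Ordinal.{0}}

theorem exists_closure_bound (hG : ∀ A, G A < ω₁) {β : Ordinal.{0}} (hβ : β < ω₁) :
    ∃ γ < ω₁, ∀ A : Finset Ordinal.{0}, (A : Set Ordinal.{0}) ⊆ Set.Iio β → G A < γ := by
  have := countable_finset_subset (countable_Iio_of_lt_omega_one hβ)
  let G' (A : {A : Finset Ordinal.{0} // (A : Set Ordinal.{0}) ⊆ Set.Iio β}) := G A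
  exact ⟨Order.succ (⨆ A, G' A), (Cardinal.isSuccLimit_omega 1).succ_lt
    (iSup_lt_omega_one fun A => hG A), fun A hA => Order.lt_succ_of_le (Ordinal.le_iSup G' ⟨A, hA⟩)⟩

theorem isClub_closurePoints (hG : ∀ A, G A < ω₁) :
    IsClub {α : Set.Iio (ω₁ : Ordinal.{0}) | ∀ A : Finset Ordinal.{0},
      (A : Set Ordinal.{0}) ⊆ Set.Iio (α : Ordinal.{0}) → G A < α} := by
  constructor
  · intro d hd hne _ a ha A hA
    have := hne.to_subtype
    have hlub x (hx : x < (a : Ordinal.{0})) : ∃ β : d, x < (β : Set.Iio ω₁) := by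
      obtain ⟨β, hβ, hxβ⟩ := (lt_isLUB_iff ha (b := ⟨x, hx.trans a.2⟩)).1 hx
      exact ⟨⟨β, hβ⟩, hxβ⟩
    obtain ⟨β, hβ⟩ := exists_subset_Iio hlub hA
    exact (hd β.2 A hβ).trans_le (ha.1 β.2)
  · rintro ⟨α, hα⟩
    choose! g hg hcl using fun (β : Ordinal.{0}) (hβ : β < ω₁) => exists_closure_bound hG hβ
    have hiter n : g^[n] α < ω₁ := by
      induction n with
      | zero => exact hα
      | succ n ih => exact g.iterate_succ_apply' n α ▸ hg _ ih
    refine ⟨⟨⨆ n, g^[n] α, iSup_lt_omega_one hiter⟩, fun A hA => ?_,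
      Ordinal.le_iSup (fun n => g^[n] α) 0⟩
    obtain ⟨n, hn⟩ := exists_subset_Iio (fun x hx => Ordinal.lt_iSup_iff.1 hx) hA
    refine (hcl _ (hiter n) A hn).trans_le ?_
    rw [← g.iterate_succ_apply' n α]
    exact Ordinal.le_iSup (fun n => g^[n] α) (n + 1)

end

theorem exists_injOn_finset_omega_one : ∃ c : Finset Ordinal.{0} → Ordinal.{0},
    (∀ A, c A < ω₁) ∧ Set.InjOn c {A | (A : Set Ordinal.{0}) ⊆ Set.Iio ω₁} := by
  classical
  have : Infinite (Set.Iio (ω₁ : Ordinal.{0})) := by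
    simp [Cardinal.infinite_iff, Cardinal.mk_Iio_ordinal]
  obtain ⟨e⟩ := Cardinal.eq.1 (Cardinal.mk_finset_of_infinite (Set.Iio (ω₁ : Ordinal.{0})))
  refine ⟨fun A => e (A.subtype (· ∈ Set.Iio ω₁)), fun A => (e _).2, fun A hA B hB h => ?_⟩
  rw [← Finset.subtype_map_of_mem (p := (· ∈ Set.Iio ω₁)) (s := A) fun x hx => hA hx,
    e.injective (Subtype.ext h), Finset.subtype_map_of_mem fun x hx => hB hx]

theorem DiamondPrinciple.exists_isGuessing (h : DiamondPrinciple) : ∃ S, IsGuessing S := by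
  obtain ⟨D, -, hD⟩ := h
  obtain ⟨c, hc, hcinj⟩ := exists_injOn_finset_omega_one
  refine ⟨fun ξ => {A | (A : Set Ordinal.{0}) ⊆ Set.Iio (ω * ξ) ∧ c A ∈ D (ω * ξ)},
    fun 𝒮 h𝒮 G hG => ?_⟩
  obtain ⟨⟨α, hα⟩, ⟨hlim, hguess⟩, hclosed⟩ := hD (c '' 𝒮) (Set.image_subset_iff.2 fun A _ => hc A)
    (isClub_closurePoints (G := fun A => max (c A) (ω * G A))
      fun A => max_lt (hc A) (omega_mul_lt_omega_one (hG A)))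
  obtain ⟨ξ, rfl⟩ : ω ∣ α := isSuccPrelimit_iff_omega0_dvd.1 hlim.isSuccPrelimit
  have hξ : 0 < ξ := pos_iff_ne_zero.2 fun h₀ => hlim.ne_bot (by simp [h₀])
  refine ⟨ξ, (le_mul_right ξ omega0_pos).trans_lt hα, hξ, fun A hA => ?_, Set.ext fun A => ?_⟩
  · exact (mul_lt_mul_iff_right₀ omega0_pos).1 ((le_max_right _ _).trans_lt (hclosed A hA))
  · refine and_comm.trans (and_congr_left fun hA => ?_)
    have hcA : c A < ω * ξ := (le_max_left _ _).trans_lt (hclosed A hA)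
    calc c A ∈ D (ω * ξ) ↔ c A ∈ c '' 𝒮 ∩ Set.Iio (ω * ξ) := by rw [hguess]
      _ ↔ c A ∈ c '' 𝒮 := and_iff_left hcA
      _ ↔ A ∈ 𝒮 := hcinj.mem_image_iff (fun B hB => (h𝒮 hB).2)
        (hA.trans (Set.Iio_subset_Iio hα.le))

/-! ### Full capturing -/

section

variable {τ : SchemeType} {X : Set Ordinal.{0}} {L L' : ℕ → Set Enumeration}
  {𝒮 : Set (Finset Ordinal.{0})} {b : Ordinal.{0}} {e e' : ℕ → Enumeration} {k j : ℕ}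
  {t : Finset ℕ} {H f g : Enumeration}

theorem Coherent.eqOn_of_enumSet_subset {m r : ℕ} (h : Coherent m f g) (hr : r ≤ m)
    (hfg : enumSet r f ⊆ enumSet r g) : Set.EqOn f g (Set.Iio r) := by
  intro s hs
  obtain ⟨p, hp, e⟩ := mem_enumSet.1 (hfg (mem_enumSet.2 ⟨s, hs, rfl⟩))
  exact (h s (lt_of_lt_of_le hs hr) p (hp.trans_le hr) e.symm).2 Set.self_mem_Iic

theorem IsMaximalCapture.succ_eq (h : IsMaximalCapture τ L 𝒮 b e k t j) (hH : H ∈ L (k + 1))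
    (hroot : Set.EqOn H (e k) (Set.Iio (τ.r (k + 1)))) (hmem : ∀ i ≤ j, copyOf τ k H t i ∈ 𝒮) :
    j + 1 = τ.n (k + 1) := by
  refine (Nat.succ_le_of_lt h.lt).eq_or_lt.resolve_right fun hlt => ?_
  exact (Nat.lt_irrefl j) (h.max _ hlt H hH hroot fun i hi => hmem i (Nat.lt_succ_iff.1 hi))

theorem IsMaximalCapture.eqOn_of_isPiece (h : IsMaximalCapture τ L' 𝒮 b e k t j)
    (hL : IsEnumeratedScheme τ X L) (he : ∀ k, e k ∈ L k) (he' : ∀ k, e' k ∈ L k)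
    (hb : b ∈ enumSet (τ.m k) (e' k)) (hp : IsPiece τ k j (e' k) (e' (k + 1))) :
    e' k (τ.r (k + 1)) = b ∧
      Set.EqOn (e' (k + 1)) (e (k + 1)) (Set.Iic (τ.shift k j (τ.r (k + 1)))) := by
  have hr := τ.r_lt_m k
  obtain ⟨p, hpm, hpb⟩ := mem_enumSet.1 hb
  obtain ⟨rfl, -⟩ := hL.coherent _ (he' k) _ (he k) p hpm _ hr (hpb.trans h.base.symm)
  refine ⟨hpb, (hL.coherent _ (he' _) _ (he _) _ (shift_lt hr h.lt) _ (shift_lt hr h.lt) ?_).2⟩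
  exact (hp hr).symm.trans ((hpb.trans h.base.symm).trans (h.piece hr))

end

theorem omega_mul_omega_one : ω * (ω₁ : Ordinal.{0}) = ω₁ :=
  isPrincipal_mul_iff_mul_left_eq.1 (isPrincipal_mul_omega 1) _ omega0_pos omega0_lt_omega_one

theorem exists_reflection_bound {ι : Type} [Countable ι] (Q : ι → Ordinal.{0} → Prop) :
    ∃ b < ω₁, ∀ i, ∀ ζ < ω₁, Q i ζ → ∃ ζ' < b, Q i ζ' := by
  have hwit i : ∃ ζ < ω₁, (∃ ζ' < ω₁, Q i ζ') → Q i ζ := by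
    by_cases h : ∃ ζ' < ω₁, Q i ζ'
    · exact h.imp fun ζ hζ => ⟨hζ.1, fun _ => hζ.2⟩
    · exact ⟨0, omega_pos 1, fun h' => absurd h' h⟩
  choose w hw hQ using hwit
  exact ⟨Order.succ (⨆ i, w i), (Cardinal.isSuccLimit_omega 1).succ_lt (iSup_lt_omega_one hw),
    fun i ζ hζ h => ⟨w i, Order.lt_succ_of_le (Ordinal.le_iSup w i), hQ i ⟨ζ, hζ, h⟩⟩⟩

section

variable {τ : SchemeType} {𝒬 : Set (Set ℕ)} {S : Ordinal.{0} → Set (Finset Ordinal.{0})}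
  {E : Ordinal.{0} → ℕ → Enumeration} {𝒮 : Set (Finset Ordinal.{0})} {ξ : Ordinal.{0}}
  {P : Set ℕ}

theorem exists_captured_copy (hE : ∀ ξ < ω₁, IsGenericBranch τ 𝒬 S E ξ (E ξ))
    (hξ : 0 < ξ) (hξω : ξ < ω₁) (hP : P ∈ 𝒬) (N : ℕ) {A : Finset Ordinal.{0}}
    (hA : A ∈ FIN (Set.Iio ω₁)) :
    ∃ ζ < ω₁, ∃ k ≥ N, k + 1 ∈ P ∧ ω * ξ ∈ enumSet (τ.m k) (E ζ k) ∧
      ∃ t ⊆ Finset.range (τ.m k), t.image (E ζ k) = A ∧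
        ∃ j, IsMaximalCapture τ (levelBelow τ E ξ) (S ξ) (ω * ξ) (E ξ) k t j ∧
          IsPiece τ k j (E ζ k) (E ζ (k + 1)) := by
  have hins : insert (ω * ξ) A ∈ FIN (Set.Iio (ω * ω₁)) := by
    rw [omega_mul_omega_one]
    refine ⟨Finset.insert_nonempty _ _, ?_⟩
    rw [Finset.coe_insert]
    exact Set.insert_subset (omega_mul_lt_omega_one hξω) hA.2
  obtain ⟨ζ, hζ, hsub⟩ := exists_subset_Iio_omega_mul_add hins
  have hξζ : ξ ≤ ζ := by
    by_contra! hlt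
    exact (omega_mul_add_omega_le hlt).not_gt (hsub (Finset.mem_insert_self _ _))
  obtain ⟨k₀, hk₀⟩ := (hE ζ hζ).exists_forall_subset hsub
  obtain ⟨k, hk, hkP, hreal⟩ := (hE ζ hζ).realizes hξ hξζ
    (fun x hx => hsub (Finset.mem_insert_of_mem hx)) hP (max N k₀)
  exact ⟨ζ, hζ, k, (le_max_left _ _).trans hk, hkP,
    hk₀ k ((le_max_right _ _).trans hk) (Finset.mem_insert_self _ _), hreal⟩

theorem exists_mem_not_subset (h𝒮 : ¬ 𝒮.Countable) {β : Ordinal.{0}} (hβ : β < ω₁) :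
    ∃ A ∈ 𝒮, ∃ x ∈ A, β ≤ x := by
  by_contra! hcon
  have := countable_finset_subset (countable_Iio_of_lt_omega_one hβ)
  exact h𝒮 ((Set.countable_coe_iff.1 this).mono fun A hA x hx => hcon A hA x hx)

theorem isEnumeratedScheme_levelBelow_omega_one
    (hE : ∀ ξ < ω₁, IsGenericBranch τ 𝒬 S E ξ (E ξ)) :
    IsEnumeratedScheme τ (Set.Iio ω₁) (levelBelow τ E ω₁) := by
  have h := isEnumeratedScheme_levelBelow fun ξ hξ => (hE ξ hξ).toIsBranch
  rwa [omega_mul_omega_one] at h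

theorem exists_maximalCapture (hE : ∀ ξ < ω₁, IsGenericBranch τ 𝒬 S E ξ (E ξ))
    (h𝒮 : 𝒮 ⊆ FIN (Set.Iio ω₁)) (hunc : ¬ 𝒮.Countable) (hξ : 0 < ξ) (hξω : ξ < ω₁)
    (hS : S ξ ⊆ 𝒮) (hP : P ∈ 𝒬) (N : ℕ) :
    ∃ ζ < ω₁, ∃ k ≥ N, k + 1 ∈ P ∧ ∃ t ⊆ Finset.range (τ.m k), (∃ s ∈ t, τ.r (k + 1) ≤ s) ∧
      ∃ j, IsMaximalCapture τ (levelBelow τ E ξ) (S ξ) (ω * ξ) (E ξ) k t j ∧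
        Set.EqOn (E ζ (k + 1)) (E ξ k) (Set.Iio (τ.r (k + 1))) ∧
        ∀ i ≤ j, copyOf τ k (E ζ (k + 1)) t i ∈ 𝒮 := by
  have hL := isEnumeratedScheme_levelBelow_omega_one hE
  obtain ⟨A, hA𝒮, x, hxA, hx⟩ := exists_mem_not_subset hunc (omega_mul_lt_omega_one hξω)
  obtain ⟨ζ, hζ, k, hk, hkP, hmem, t, ht, himg, j, hcap, hpiece⟩ :=
    exists_captured_copy hE hξ hξω hP N (h𝒮 hA𝒮)
  have hr := τ.r_lt_m k
  obtain ⟨hbase, heq⟩ :=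
    hcap.eqOn_of_isPiece hL (mem_levelBelow hξω) (mem_levelBelow hζ) hmem hpiece
  have hshift : τ.r (k + 1) ≤ τ.shift k j (τ.r (k + 1)) := le_shift
  refine ⟨ζ, hζ, k, hk, hkP, t, ht, ?_, j, hcap, fun s hs => ?_, fun i hij => ?_⟩
  · obtain ⟨s, hs, rfl⟩ := Finset.mem_image.1 (himg ▸ hxA)
    refine ⟨s, hs, ?_⟩
    rw [← hbase] at hx
    exact ((hL.strictMonoOn _ (mem_levelBelow hζ k)).le_iff_le hr (Finset.mem_range.1 (ht hs))).1 hx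
  · rw [heq (hs.le.trans hshift), hcap.piece (lt_trans hs hr), Function.comp, shift_of_lt hs]
  · rcases hij.eq_or_lt with rfl | hij
    · have hcopy : copyOf τ k (E ζ (k + 1)) t i = A :=
        (Finset.image_congr fun s hs => (hpiece (Finset.mem_range.1 (ht hs))).symm).trans himg
      exact hcopy ▸ hA𝒮
    · have hcopy : copyOf τ k (E ζ (k + 1)) t i = copyOf τ k (E ξ (k + 1)) t i :=
        Finset.image_congr fun s hs =>
          heq (shift_lt_shift (Finset.mem_range.1 (ht hs)) le_rfl hij).le
      exact hcopy ▸ hS (hcap.mem i hij)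

theorem succ_eq_of_reflection (hE : ∀ ξ < ω₁, IsGenericBranch τ 𝒬 S E ξ (E ξ)) (hξω : ξ < ω₁)
    (hS : S ξ = {A ∈ 𝒮 | (A : Set Ordinal.{0}) ⊆ Set.Iio (ω * ξ)}) {ζ : Ordinal.{0}} (hζ : ζ < ξ)
    {k j : ℕ} {t : Finset ℕ} (ht : t ⊆ Finset.range (τ.m k))
    (hcap : IsMaximalCapture τ (levelBelow τ E ξ) (S ξ) (ω * ξ) (E ξ) k t j)
    (hroot : enumSet (τ.r (k + 1)) (E ζ (k + 1)) = enumSet (τ.r (k + 1)) (E ξ k))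
    (hmem : ∀ i ≤ j, copyOf τ k (E ζ (k + 1)) t i ∈ 𝒮) : j + 1 = τ.n (k + 1) := by
  have hL := isEnumeratedScheme_levelBelow_omega_one hE
  have hLξ := isEnumeratedScheme_levelBelow fun η hη => (hE η (hη.trans hξω)).toIsBranch
  have hcoh : Coherent (τ.m k) (E ζ (k + 1)) (E ξ k) := by
    have hpiece := hL.piece_mem _ (mem_levelBelow (hζ.trans hξω) (k + 1)) 0 (τ.n_pos k)
    simpa [Function.comp_def] using hL.coherent _ hpiece _ (mem_levelBelow hξω k)
  refine hcap.succ_eq (mem_levelBelow hζ (k + 1))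
    (hcoh.eqOn_of_enumSet_subset (τ.r_lt_m k).le hroot.subset) fun i hij => ?_
  rw [hS]
  exact ⟨hmem i hij, (Finset.coe_subset.2 (copyOf_subset ht _ (hij.trans_lt hcap.lt))).trans
    (hLξ.enumSet_mem_FIN (mem_levelBelow hζ (k + 1))).2⟩

theorem isFullyCapturing_levelBelow (hE : ∀ ξ < ω₁, IsGenericBranch τ 𝒬 S E ξ (E ξ))
    (hS : IsGuessing S) :
    IsFullyCapturing τ (Set.Iio ω₁) (enumFamily τ (levelBelow τ E ω₁)) 𝒬 := by
  have hL := isEnumeratedScheme_levelBelow_omega_one hE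
  intro 𝒮 h𝒮 hunc P hP
  refine Set.infinite_of_forall_exists_gt fun N => ?_
  let Q (R : Finset Ordinal.{0}) (d : ℕ × Finset ℕ × ℕ) (ζ : Ordinal.{0}) : Prop :=
    enumSet (τ.r (d.1 + 1)) (E ζ (d.1 + 1)) = R ∧
      ∀ i ≤ d.2.2, copyOf τ d.1 (E ζ (d.1 + 1)) d.2.1 i ∈ 𝒮
  choose G hG hGQ using fun R => exists_reflection_bound (Q R)
  obtain ⟨ξ, hξω, hξ, hclosed, hSξ⟩ := hS 𝒮 h𝒮 G hG
  obtain ⟨ζ, hζ, k, hk, hkP, t, ht, htr, j, hcap, hroot, hmem⟩ :=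
    exists_maximalCapture hE h𝒮 hunc hξ hξω (hSξ ▸ Set.sep_subset _ _) hP N
  have hr := τ.r_lt_m k
  have hRξ : (enumSet (τ.r (k + 1)) (E ξ k) : Set Ordinal.{0}) ⊆ Set.Iio (ω * ξ) := fun x hx => by
    obtain ⟨s, hs, rfl⟩ := mem_enumSet.1 hx
    exact hcap.base ▸ hL.strictMonoOn _ (mem_levelBelow hξω k) (hs.trans hr) hr hs
  obtain ⟨ζ₀, hζ₀, hroot₀, hmem₀⟩ := hGQ _ (k, t, j) ζ hζ ⟨enumSet_congr hroot, hmem⟩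
  have hj : j + 1 = τ.n (k + 1) := succ_eq_of_reflection hE hξω hSξ
    (hζ₀.trans (hclosed _ hRξ)) ht hcap hroot₀ hmem₀
  refine ⟨k + 1, ⟨hkP, _, ?_, hL.isFullyCaptured_copyOf (mem_levelBelow hζ _) ht htr⟩,
    Nat.lt_succ_of_le hk⟩
  rw [Finset.coe_image, Set.image_subset_iff]
  intro i hi
  rw [Finset.coe_range, ← hj] at hi
  exact hmem i (Nat.lt_succ_iff.1 hi)

end

theorem countable_of_isPartition {α : Type*} [Countable α] {𝒬 : Set (Set α)}
    (h : Setoid.IsPartition 𝒬) : 𝒬.Countable := by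
  choose! f hf using fun a => (h.2 a).exists
  refine (Set.countable_range f).mono fun Q hQ => ?_
  obtain ⟨a, ha⟩ := Setoid.nonempty_of_mem_partition h hQ
  exact ⟨a, (h.2 a).unique (hf a) ⟨hQ, ha⟩⟩

end ConstructionScheme

theorem mainTheorem1_general (hDiamond : ConstructionScheme.DiamondPrinciple)
    (τ : ConstructionScheme.SchemeType) (hτ : τ.IsGood)
    (𝒬 : Set (Set ℕ)) (h𝒬 : 𝒬.Countable) (hcomp : τ.Compatible 𝒬) :
    ∃ ℱ : Set (Finset Ordinal.{0}),
      ConstructionScheme.IsConstructionScheme τ (Set.Iio (Ordinal.omega 1)) ℱ ∧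
      ConstructionScheme.IsFullyCapturing τ (Set.Iio (Ordinal.omega 1)) ℱ 𝒬 := by
  obtain ⟨S, hS⟩ := hDiamond.exists_isGuessing
  have hcomp' : τ.Compatible (insert Set.univ 𝒬) := by
    rintro P (rfl | hP) c
    · simpa using hτ c
    · exact hcomp P hP c
  obtain ⟨E, hE⟩ := ConstructionScheme.exists_genericBranches (h𝒬.insert Set.univ)
    (Set.insert_nonempty _ _) hcomp' S
  refine ⟨_, (ConstructionScheme.isEnumeratedScheme_levelBelow_omega_one hE).isConstructionScheme,
    fun 𝒮 h𝒮 hunc P hP => ?_⟩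
  exact ConstructionScheme.isFullyCapturing_levelBelow hE hS 𝒮 h𝒮 hunc P (.inr hP)

theorem mainTheorem1 (hDiamond : ConstructionScheme.DiamondPrinciple)
    (τ : ConstructionScheme.SchemeType) (hτ : τ.IsGood)
    (𝒬 : Set (Set ℕ)) (h𝒬 : Setoid.IsPartition 𝒬) (hcomp : τ.Compatible 𝒬) :
    ∃ ℱ : Set (Finset Ordinal.{0}),
      ConstructionScheme.IsConstructionScheme τ (Set.Iio (Ordinal.omega 1)) ℱ ∧
      ConstructionScheme.IsFullyCapturing τ (Set.Iio (Ordinal.omega 1)) ℱ 𝒬 :=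
  mainTheorem1_general hDiamond τ hτ 𝒬 (ConstructionScheme.countable_of_isPartition h𝒬) hcomp
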